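/- Scalars are real or complex. The density character of a topological space is the least cardinality of a dense subset. A Banach space $E$ is *uncomplemented in a superspace of density character $\kappa$* if there are a Banach space $X$ of density character $\kappa$ and a linear isometric embedding $J:E\to X$ such that there is no bounded linear projection of $X$ onto $J(E)$; $E$ is *injective* if for every Banach space $X$ and every linear isometric embedding $J:E\to X$ there is a bounded linear projection of $X$ onto $J(E)$. *Jigsaws of closed sets.* Let $K$ be a compact Hausdorff space and $n\ge 1$. Closed sets $F_0,\dots,F_{n-1}\subseteq K$ form a jigsaw of closed sets if $\bigcap_{i<n}F_i\ne\emptyset$ and, for all nonempty proper subsets $A,B$ of $\{0,\dots,n-1\}$ with $B\subsetneq A$, the set $\bigcap_{i\in B}F_i\setminus\bigcap_{i\in A}F_i$ is dense in $\bigcap_{i\in B}F_i$. The jigsaw is dense if $\bigcup_{i<n}F_i=K$. *Jigsaws in Boolean algebras.* Let $\mathcal B$ be a Boolean algebra. For an ideal $I$ and $a\in\mathcal B$ put $I|_a=\{b\in I: b\le a\}$, and for $S\subseteq\mathcal B$ put $S^\perp=\{b: a\wedge b=0\ \forall a\in S\}$. A finite family $\{I_i:i\in n\}$ of ideals is a multiple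 gap ($n$-gap) if the ideals are mutually orthogonal ($a\wedge b=0$ for $a\in I_i$, $b\in I_j$, $i\neq j$) and $\bigwedge_{i}c_i\ne0$ whenever $c_i\in\mathcal B$ is an upper bound of $I_i$ for every $i$. It is dense if $(\bigvee_i I_i)^\perp=\{0\}$, where $\bigvee_i I_i=\{\bigvee_i a_i : a_i\in I_i\}$. An $n$-gap is an $n$-jigsaw if for every nonempty proper subset $B$ of $n$, every $A$ with $B\subseteq A\subseteq n$ and every $a\in\mathcal B$ such that $\{I_i|_a:i\in A\}$ is a multiple gap, there is $b\le a$ such that $\{I_i|_b:i\in B\}$ is a multiple gap and $b\in I_i^\perp$ for all $i\in A\setminus B$. $St(\mathcal B)$ is the Stone space of ultrafilters of $\mathcal B$, with the topology generated by the sets $\{\mathfrak U: a\in\mathfrak U\}$, $a\in\mathcal B$. **Theorem.** 1. Let $K$ be a compact Hausdorff space such that for every $n\ge1$ there is a dense jigsaw of $n$ closed sets in $K$. Then $C(K)$ is uncomplemented in a superspace of the same density character as $C(K)$. 2. If a Boolean algebra $\mathcal B$ has a dense $n$-jigsaw for every $n\ge1$, then $C(St(\mathcal B))$ is uncomplemented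 in a superspace of the same density character as $C(St(\mathcal B))$, and this density character is $|\mathcal B|$. 3. The Boolean algebra $\mathcal P(\omega)/\mathrm{fin}$ has a dense $n$-jigsaw for every $n\ge1$, and $\ell_\infty/c_0$ is uncomplemented in a superspace of density character $\mathfrak c=2^{\aleph_0}$. In particular (Amir) $\ell_\infty/c_0$ is not injective. -/

import Mathlib

open Filter Topology
open scoped ENNReal Cardinal

universe u v w

noncomputable section

/-! ### Complemented subspaces, injectivity, density character -/

/-- The density character of a topological space: the least cardinality of a dense subset. -/
def densityCharacter (X : Type w) [TopologicalSpace X] : Cardinal.{w} :=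
  sInf {κ : Cardinal.{w} | ∃ s : Set X, Dense s ∧ #s = κ}

/-- The Banach space `E` is uncomplemented in some superspace of density character `κ`: there are
a Banach space `X` with density character `κ` and a linear isometric embedding `J : E → X` such
that no bounded linear operator is a projection of `X` onto the image of `E`. -/
def UncomplementedInSuperspace (𝕜 : Type v) [RCLike 𝕜] (E : Type w) [NormedAddCommGroup E]
    [NormedSpace 𝕜 E] (κ : Cardinal.{w}) : Prop :=
  ∃ (X : Type w) (_ : NormedAddCommGroup X) (_ : NormedSpace 𝕜 X) (_ : CompleteSpace X)
    (J : E →ₗᵢ[𝕜] X),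
    densityCharacter X = κ ∧ ¬ (LinearMap.range J.toLinearMap).ClosedComplemented

/-- `E` is an injective Banach space: it is complemented in each of its Banach superspaces. -/
def IsInjectiveBanachSpace (𝕜 : Type v) [RCLike 𝕜] (E : Type w) [NormedAddCommGroup E]
    [NormedSpace 𝕜 E] : Prop :=
  ∀ (X : Type w) [NormedAddCommGroup X] [NormedSpace 𝕜 X] [CompleteSpace X] (J : E →ₗᵢ[𝕜] X),
    (LinearMap.range J.toLinearMap).ClosedComplemented

/-! ### Jigsaws of closed sets -/

/-- The closed sets `F i`, `i < n`, with a common point, form a jigsaw: for all nonempty proper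
subsets `B ⊊ A` of the index set, `⋂_{i ∈ B} F i \ ⋂_{i ∈ A} F i` is dense in `⋂_{i ∈ B} F i`. -/
structure IsClosedJigsaw {K : Type u} [TopologicalSpace K] {n : ℕ} (F : Fin n → Set K) :
    Prop where
  isClosed : ∀ i, IsClosed (F i)
  nonempty : (⋂ i, F i).Nonempty
  dense : ∀ A B : Set (Fin n), B.Nonempty → B ⊂ A → A ≠ Set.univ →
    (⋂ i ∈ B, F i) ⊆ closure ((⋂ i ∈ B, F i) \ (⋂ i ∈ A, F i))

/-- A jigsaw of closed sets is dense if the sets cover the space. -/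
structure IsDenseClosedJigsaw {K : Type u} [TopologicalSpace K] {n : ℕ} (F : Fin n → Set K) :
    Prop extends IsClosedJigsaw F where
  iUnion_eq : (⋃ i, F i) = Set.univ

/-! ### Multiple gaps and jigsaws in Boolean algebras -/

section BooleanAlgebra

variable {𝓑 : Type u} [BooleanAlgebra 𝓑]

/-- `S^⊥`, the set of the elements disjoint from every element of `S`. -/
def orthogonalSet (S : Set 𝓑) : Set 𝓑 := {b | ∀ a ∈ S, a ⊓ b = ⊥}

/-- `I|_a`, the ideal of the elements of `I` below `a`. -/
def restrictIdeal (I : Order.Ideal 𝓑) (a : 𝓑) : Order.Ideal 𝓑 := I ⊓ Order.Ideal.principal a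

theorem mem_restrictIdeal {I : Order.Ideal 𝓑} {a b : 𝓑} :
    b ∈ restrictIdeal I a ↔ b ∈ I ∧ b ≤ a := by
  simp [restrictIdeal]

/-- A finite family of ideals is a multiple gap if the ideals are mutually orthogonal and cannot
be separated by elements with zero meet. -/
structure IsMultipleGap {ι : Type*} [Fintype ι] (I : ι → Order.Ideal 𝓑) : Prop where
  orthogonal : ∀ i j, i ≠ j → ∀ a ∈ I i, ∀ b ∈ I j, a ⊓ b = ⊥
  not_separated : ∀ c : ι → 𝓑, (∀ i, ∀ a ∈ I i, a ≤ c i) → Finset.univ.inf c ≠ ⊥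

/-- A multiple gap is dense if the orthogonal of `⋁ I i` (the set of joins of elements of
the ideals `I i`) is zero. -/
structure IsDenseMultipleGap {ι : Type*} [Fintype ι] (I : ι → Order.Ideal 𝓑) : Prop
    extends IsMultipleGap I where
  dense : orthogonalSet {x : 𝓑 | ∃ f : ι → 𝓑, (∀ i, f i ∈ I i) ∧ x = Finset.univ.sup f} = {⊥}

/-- The `B`-jigsaw condition for a family of ideals indexed by `n`. -/
def IsJigsawAt {n : ℕ} (I : Fin n → Order.Ideal 𝓑) (B : Finset (Fin n)) : Prop :=
  ∀ A : Finset (Fin n), B ⊆ A → ∀ a : 𝓑, IsMultipleGap (fun i : A => restrictIdeal (I i) a) →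
    ∃ b ≤ a, IsMultipleGap (fun i : B => restrictIdeal (I i) b) ∧
      ∀ i ∈ A \ B, b ∈ orthogonalSet (I i : Set 𝓑)

/-- A dense `n`-jigsaw: a dense `n`-gap which is a `B`-jigsaw for all nonempty proper `B`. -/
structure IsDenseJigsaw {n : ℕ} (I : Fin n → Order.Ideal 𝓑) : Prop
    extends IsDenseMultipleGap I where
  jigsaw : ∀ B : Finset (Fin n), B.Nonempty → B ≠ Finset.univ → IsJigsawAt I B

end BooleanAlgebra

/-- The Boolean algebra `𝓑` has dense `n`-jigsaws for every positive integer `n`. -/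
def HasDenseJigsaws (𝓑 : Type u) [BooleanAlgebra 𝓑] : Prop :=
  ∀ n : ℕ, 1 ≤ n → ∃ I : Fin n → Order.Ideal 𝓑, IsDenseJigsaw I

/-! ### The Stone space of a Boolean algebra -/

/-- The points of the Stone space: the ultrafilters of the Boolean algebra. -/
@[ext]
structure StoneSpace (𝓑 : Type u) [BooleanAlgebra 𝓑] where
  carrier : Set 𝓑
  top_mem : ⊤ ∈ carrier
  bot_notMem : ⊥ ∉ carrier
  mem_of_le : ∀ {a b : 𝓑}, a ∈ carrier → a ≤ b → b ∈ carrier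
  inf_mem : ∀ {a b : 𝓑}, a ∈ carrier → b ∈ carrier → a ⊓ b ∈ carrier
  mem_or_compl_mem : ∀ a : 𝓑, a ∈ carrier ∨ aᶜ ∈ carrier

namespace StoneSpace

variable {𝓑 : Type u} [BooleanAlgebra 𝓑]

/-- The topology is generated by the sets `{U | a ∈ U}`. -/
instance : TopologicalSpace (StoneSpace 𝓑) :=
  TopologicalSpace.generateFrom {s | ∃ a : 𝓑, s = {U | a ∈ U.carrier}}

instance : CompactSpace (StoneSpace 𝓑) := by
  refine ⟨isCompact_iff_ultrafilter_le_nhds.2 fun G _ => ?_⟩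
  let V : StoneSpace 𝓑 :=
    { carrier := {a | ∀ᶠ U in (G : Filter (StoneSpace 𝓑)), a ∈ U.carrier}
      top_mem := Eventually.of_forall fun U => U.top_mem
      bot_notMem := fun h => by
        obtain ⟨U, hU⟩ := h.exists
        exact U.bot_notMem hU
      mem_of_le := fun h hab => h.mono fun U hU => U.mem_of_le hU hab
      inf_mem := fun ha hb => (ha.and hb).mono fun U hU => U.inf_mem hU.1 hU.2
      mem_or_compl_mem := fun a =>
        Ultrafilter.eventually_or.1 (Eventually.of_forall fun U => U.mem_or_compl_mem a) }
  refine ⟨V, trivial, ?_⟩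
  rw [TopologicalSpace.nhds_generateFrom]
  refine le_iInf₂ fun s hs => ?_
  obtain ⟨hV, a, rfl⟩ := hs
  exact le_principal_iff.2 hV

end StoneSpace

/-! ### The Boolean algebra `𝓟(ω)/fin` and the Banach space `ℓ_∞/c₀` -/

/-- `𝓟(ω)/fin`: subsets of `ℕ`, seen as predicates, modulo equality up to finitely many points,
with the operations induced by those of the power set. -/
def PowerSetModFin : Type := (cofinite : Filter ℕ).Germ Prop

namespace PowerSetModFin

/-- The class of a set of natural numbers modulo finite sets. -/
def mk (s : Set ℕ) : PowerSetModFin := ((fun k => k ∈ s : ℕ → Prop) : (cofinite : Filter ℕ).Germ Prop)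

instance : BooleanAlgebra PowerSetModFin where
  __ := (inferInstance : DistribLattice ((cofinite : Filter ℕ).Germ Prop))
  top := mk Set.univ
  bot := mk ∅
  compl := Germ.map Not
  le_top := fun a => Germ.inductionOn a fun _ => Eventually.of_forall fun _ _ => trivial
  bot_le := fun a => Germ.inductionOn a fun _ => Eventually.of_forall fun _ h => h.elim
  inf_compl_le_bot := fun a =>
    Germ.inductionOn a fun _ => Eventually.of_forall fun _ h => h.2 h.1
  top_le_sup_compl := fun a =>
    Germ.inductionOn a fun _ => Eventually.of_forall fun _ _ => Classical.em _

theorem mk_surjective : Function.Surjective mk := fun a =>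
  Germ.inductionOn a fun p => ⟨{k | p k}, rfl⟩

theorem mk_le_mk {s t : Set ℕ} : mk s ≤ mk t ↔ (s \ t).Finite := by
  change (∀ᶠ k in cofinite, (k ∈ s → k ∈ t)) ↔ _
  rw [eventually_cofinite]
  have : {k | ¬ (k ∈ s → k ∈ t)} = s \ t := by
    ext k
    simp
  rw [this]

theorem mk_inter (s t : Set ℕ) : mk (s ∩ t) = mk s ⊓ mk t := rfl

theorem mk_union (s t : Set ℕ) : mk (s ∪ t) = mk s ⊔ mk t := rfl

theorem mk_compl (s : Set ℕ) : mk sᶜ = (mk s)ᶜ := rfl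

end PowerSetModFin

/-- The Banach space `ℓ_∞` of bounded sequences of scalars. -/
abbrev LInfty (𝕜 : Type v) [RCLike 𝕜] : Type v := lp (fun _ : ℕ => 𝕜) ⊤

/-- The subspace `c₀` of `ℓ_∞` of the sequences converging to zero. -/
def cZero (𝕜 : Type v) [RCLike 𝕜] : Submodule 𝕜 (LInfty 𝕜) where
  carrier := {x | Tendsto (fun k => x k) atTop (𝓝 0)}
  add_mem' := fun {x y} hx hy => by simpa using Tendsto.add hx hy
  zero_mem' := by simp
  smul_mem' := fun c x hx => by simpa using Tendsto.const_smul hx c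

instance cZero_isClosed (𝕜 : Type v) [RCLike 𝕜] : IsClosed (cZero 𝕜 : Set (LInfty 𝕜)) := by
  refine isClosed_of_closure_subset fun x hx => ?_
  change Tendsto (fun k => x k) atTop (𝓝 0)
  rw [Metric.tendsto_atTop]
  intro ε hε
  obtain ⟨y, hy, hxy⟩ := Metric.mem_closure_iff.1 hx (ε / 2) (half_pos hε)
  obtain ⟨N, hN⟩ := Metric.tendsto_atTop.1 (show Tendsto (fun k => y k) atTop (𝓝 0) from hy)
    (ε / 2) (half_pos hε)
  refine ⟨N, fun k hk => ?_⟩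
  have h1 : dist (x k) (y k) ≤ dist x y := by
    rw [dist_eq_norm, dist_eq_norm]
    exact lp.norm_apply_le_norm ENNReal.top_ne_zero (x - y) k
  calc dist (x k) 0 ≤ dist (x k) (y k) + dist (y k) 0 := dist_triangle _ _ _
    _ < ε / 2 + ε / 2 := add_lt_add (h1.trans_lt hxy) (hN k hk)
    _ = ε := add_halves ε

/-- The Banach space `ℓ_∞/c₀` with the quotient norm. -/
abbrev LInftyModCZero (𝕜 : Type v) [RCLike 𝕜] : Type v := LInfty 𝕜 ⧸ cZero 𝕜

end

/-! Part 1. Choose a dense jigsaw of each size and let `L` be the compact set of pairs `(x, s)`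
where `s` names, for each jigsaw, a member containing `x`. The projection of `L` onto `K` is
surjective, so `C(K)` embeds isometrically in `C(L)`. Multiplying the lift of `f` by the indicator
of sheet `i` of the `n`-th jigsaw gives countably many continuous linear copies of `C(K)` in `C(L)`.
Their closed span `X` contains `C(K)` and has the same density character.

A projection of `X` onto `C(K)` gives, for each jigsaw, operators `P i` on `C(K)` that sum to the
identity and kill the functions vanishing on `F i`. Near a point lying in `F i` exactly for `i ∈ B`,
only the `P i` with `i ∈ B` act on a bump `u`, and they share the value 1. Some half `B'` of `B`
receives at most 1/2. At a nearby point exact for `B'`, a narrower bump `w` gives `B'` the whole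
value 1, so adding `w - u` on the sheets of `B'` gains almost 1/2. Since `w - u` vanishes near the
new point and is supported where the earlier corrections vanish, the norm stays at most 1. With `2 ^
m` sets this repeats `m` times (`IsClosedJigsaw.exists_large_value`), so the projection has norm at
least `m / 4` for every large `m`, which is absurd (`not_closedComplemented_jigsawEmbedding`).

Part 2. An ideal `I` yields the closed set `hull I` in the Stone space. By the prime ideal theorem,
restrictions to `a` form a gap iff the hulls meet inside the clopen set of `a`
(`StoneSpace.not_separated_iff`), so algebraic jigsaws become closed ones. Indicators of clopen sets
have dense span and are 1-separated, which gives the density character.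

Part 3. Jigsaws of ideals of sets are built by recursion on `ℕ × ℕ` (`IsSetJigsaw.succIdeals`).
Limits along ultrafilters identify `ℓ_∞/c₀` with `C(St(𝓟(ω)/fin))`. -/

section DensityCharacter

/-! ### Density characters of subspaces and of spans. -/

theorem exists_dense_card_eq_densityCharacter (X : Type w) [TopologicalSpace X] :
    ∃ s : Set X, Dense s ∧ #s = densityCharacter X :=
  csInf_mem (s := {κ : Cardinal.{w} | ∃ s : Set X, Dense s ∧ #s = κ})
    ⟨_, Set.univ, dense_univ, rfl⟩

theorem densityCharacter_le_of_dense {X : Type w} [TopologicalSpace X] {s : Set X}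
    (hs : Dense s) : densityCharacter X ≤ #s :=
  csInf_le' ⟨s, hs, rfl⟩

theorem aleph0_le_densityCharacter (X : Type w) [TopologicalSpace X] [T1Space X] [Infinite X] :
    ℵ₀ ≤ densityCharacter X := by
  obtain ⟨s, hs, h⟩ := exists_dense_card_eq_densityCharacter X
  rw [← h, Cardinal.aleph0_le_mk_iff, Set.infinite_coe_iff]
  intro hfin
  have h1 : s = Set.univ := by rw [← hfin.isClosed.closure_eq, hs.closure_eq]
  exact Set.infinite_univ (h1 ▸ hfin)

/-- Density passes to metric subspaces: for each `d ∈ D` and each `n`, pick a point of `E` whose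
image is within `1 / (n + 1)` of `d`, if there is one. -/
theorem densityCharacter_le_of_isometry {E X : Type w} [PseudoMetricSpace E]
    [PseudoMetricSpace X] {j : E → X} (hj : Isometry j) {D : Set X}
    (hD : Set.range j ⊆ closure D) : densityCharacter E ≤ max ℵ₀ #D := by
  classical
  rcases isEmpty_or_nonempty E with hE | hE
  · have : Dense (∅ : Set E) := fun x => hE.elim x
    exact (densityCharacter_le_of_dense this).trans (by simp)
  let f : D × ℕ → E := fun p =>
    if h : ∃ x, dist (j x) p.1 < 1 / (p.2 + 1 : ℝ) then h.choose else Classical.arbitrary E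
  have hf : Dense (Set.range f) := by
    refine Metric.dense_iff.2 fun x r hr => ?_
    obtain ⟨n, hn⟩ := exists_nat_one_div_lt (half_pos hr)
    obtain ⟨d, hd, hxd⟩ := Metric.mem_closure_iff.1 (hD ⟨x, rfl⟩) (1 / (n + 1 : ℝ))
      (by positivity)
    have h : ∃ x, dist (j x) d < 1 / (n + 1 : ℝ) := ⟨x, hxd⟩
    refine ⟨f (⟨d, hd⟩, n), ?_, ⟨_, rfl⟩⟩
    have h1 : f (⟨d, hd⟩, n) = h.choose := dif_pos h
    rw [h1, Metric.mem_ball, ← hj.dist_eq]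
    calc dist (j h.choose) (j x) ≤ dist (j h.choose) d + dist (j x) d := dist_triangle_right _ _ _
      _ < r := by linarith [h.choose_spec]
  calc densityCharacter E ≤ #(Set.range f) := densityCharacter_le_of_dense hf
    _ ≤ #(D × ℕ) := Cardinal.mk_range_le
    _ = #D * ℵ₀ := by simp
    _ ≤ max (max #D ℵ₀) ℵ₀ := Cardinal.mul_le_max _ _
    _ = max ℵ₀ #D := by rw [max_assoc, max_self, max_comm]

theorem densityCharacter_mono_of_isometry {E X : Type w} [PseudoMetricSpace E]
    [MetricSpace X] [Infinite X] {j : E → X} (hj : Isometry j) :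
    densityCharacter E ≤ densityCharacter X := by
  obtain ⟨D, hD, h⟩ := exists_dense_card_eq_densityCharacter X
  have h1 := densityCharacter_le_of_isometry hj (D := D) (by simp [hD.closure_eq])
  rwa [h, max_eq_right (aleph0_le_densityCharacter X)] at h1

/-- Finite combinations with coefficients in a countable dense set of scalars suffice. They form an
additive monoid, so its closure need only be shown to contain the scalar multiples of elements of
`S`. -/
theorem exists_card_le_span_subset_closure (𝕜 : Type v) [RCLike 𝕜] {E : Type w}
    [NormedAddCommGroup E] [NormedSpace 𝕜 E] (S : Set E) :
    ∃ D : Set E, #D ≤ max ℵ₀ #S ∧ (Submodule.span 𝕜 S : Set E) ⊆ closure D := by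
  let f : List (ℕ × S) → E := fun l =>
    (l.map fun p => TopologicalSpace.denseSeq 𝕜 p.1 • (p.2 : E)).sum
  let M : AddSubmonoid E :=
    { carrier := Set.range f
      zero_mem' := ⟨[], by simp [f]⟩
      add_mem' := by
        rintro _ _ ⟨l, rfl⟩ ⟨l', rfl⟩
        exact ⟨l ++ l', by simp [f]⟩ }
  refine ⟨Set.range f, ?_, ?_⟩
  · calc #(Set.range f) ≤ #(List (ℕ × S)) := Cardinal.mk_range_le
      _ ≤ max ℵ₀ #(ℕ × S) := Cardinal.mk_list_le_max _
      _ ≤ max ℵ₀ #S := by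
        refine max_le (le_max_left _ _) ?_
        rw [Cardinal.mk_prod]
        simp only [Cardinal.mk_eq_aleph0, Cardinal.lift_aleph0, Cardinal.lift_uzero]
        refine (Cardinal.mul_le_max _ _).trans ?_
        simp
  · intro x hx
    change x ∈ M.topologicalClosure
    refine Submodule.closure_induction (p := fun x _ => x ∈ M.topologicalClosure) (zero_mem _)
      (fun _ _ _ _ h h' => add_mem h h') (fun c y hy => ?_) hx
    have h1 : c ∈ closure (Set.range (TopologicalSpace.denseSeq 𝕜)) :=
      TopologicalSpace.denseRange_denseSeq 𝕜 c
    refine map_mem_closure (f := fun c : 𝕜 => c • y) (by fun_prop) h1 ?_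
    rintro _ ⟨k, rfl⟩
    exact ⟨[(k, ⟨y, hy⟩)], by simp [f]⟩

end DensityCharacter

/-! ### Operators subordinate to a jigsaw of closed sets have large norm. -/

section ClosedJigsaw

/-- The points that belong to `F i` exactly for the indices `i ∈ B`. -/
def exactPoints {K : Type u} {n : ℕ} (F : Fin n → Set K) (B : Finset (Fin n)) : Set K :=
  {x | ∀ i, x ∈ F i ↔ i ∈ B}

/-- The sets `F i` with `i ∉ B` are left one at a time by density for the pair `B ⊂ insert i B`;
those already left stay avoided because they are closed. The cardinality bound makes `insert i B`
proper, as the jigsaw condition requires. -/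
theorem IsClosedJigsaw.exists_mem_exactPoints {K : Type u} [TopologicalSpace K] {n : ℕ}
    {F : Fin n → Set K} (hF : IsClosedJigsaw F) {B : Finset (Fin n)} (hB : B.Nonempty)
    (hcard : B.card + 2 ≤ n) {V : Set K} (hV : IsOpen V) {x : K} (hxV : x ∈ V)
    (hx : ∀ i ∈ B, x ∈ F i) : ∃ y ∈ V, y ∈ exactPoints F B := by
  have key : ∀ T : Finset (Fin n), Disjoint T B → ∃ y ∈ V, (∀ i ∈ B, y ∈ F i) ∧ ∀ i ∈ T, y ∉ F i := by
    intro T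
    induction T using Finset.induction_on with
    | empty => exact fun _ => ⟨x, hxV, hx, by simp⟩
    | insert i T hi ih =>
      intro hT
      rw [Finset.disjoint_insert_left] at hT
      obtain ⟨y, hyV, hyB, hyT⟩ := ih hT.2
      have hV' : IsOpen (V ∩ ⋂ j ∈ T, (F j)ᶜ) :=
        hV.inter (isOpen_biInter_finset fun j _ => (hF.isClosed j).isOpen_compl)
      have h1 := hF.dense (insert i (B : Set (Fin n))) B hB
        (Set.ssubset_insert (by simpa using hT.1)) (by
          intro h
          have h2 : insert i B = Finset.univ := by
            rw [← Finset.coe_eq_univ, ← h]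
            simp
          have h3 := Finset.card_insert_le i B
          rw [h2, Finset.card_univ, Fintype.card_fin] at h3
          omega)
      have h2 : y ∈ ⋂ j ∈ (B : Set (Fin n)), F j := by simpa using hyB
      obtain ⟨z, hzV, hzB, hzi⟩ := mem_closure_iff.1 (h1 h2) _ hV' ⟨hyV, by simpa using hyT⟩
      have hzB' : ∀ j ∈ B, z ∈ F j := by simpa using hzB
      refine ⟨z, hzV.1, hzB', fun j hj => ?_⟩
      rcases Finset.mem_insert.1 hj with rfl | hj
      · intro hzj
        apply hzi
        simp only [Set.mem_iInter, Set.mem_insert_iff, Finset.mem_coe]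
        rintro k (rfl | hk)
        · exact hzj
        · exact hzB' k hk
      · have h3 := hzV.2
        simp only [Set.mem_iInter] at h3
        exact h3 j hj
  obtain ⟨y, hyV, hyB, hyT⟩ := key Bᶜ disjoint_compl_left
  exact ⟨y, hyV, fun i => ⟨fun h => by_contra fun hi => hyT i (by simpa using hi) h, hyB i⟩⟩

theorem exists_bump {K : Type u} [TopologicalSpace K] [CompactSpace K] [T2Space K] {V : Set K}
    (hV : IsOpen V) {x : K} (hx : x ∈ V) :
    ∃ (φ : C(K, ℝ)) (N : Set K), IsOpen N ∧ x ∈ N ∧ N ⊆ V ∧ (∀ y ∈ N, φ y = 1) ∧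
      (∀ y ∉ V, φ y = 0) ∧ ∀ y, φ y ∈ Set.Icc (0 : ℝ) 1 := by
  obtain ⟨t, ht, htc, htV⟩ := exists_mem_nhds_isClosed_subset (hV.mem_nhds hx)
  obtain ⟨φ, h0, h1, h2⟩ := exists_continuous_zero_one_of_isClosed hV.isClosed_compl htc
    (Set.disjoint_left.2 fun y hy hyt => hy (htV hyt))
  exact ⟨φ, interior t, isOpen_interior, mem_interior_iff_mem_nhds.2 ht,
    interior_subset.trans htV, fun y hy => h1 (interior_subset hy), fun y hy => h0 hy, h2⟩

/-- A real function as a scalar function. -/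
def scalarFunction (𝕜 : Type v) [RCLike 𝕜] {K : Type u} [TopologicalSpace K] (φ : C(K, ℝ)) :
    C(K, 𝕜) :=
  ⟨fun x => (φ x : 𝕜), RCLike.continuous_ofReal.comp φ.continuous⟩

theorem scalarFunction_apply (𝕜 : Type v) [RCLike 𝕜] {K : Type u} [TopologicalSpace K]
    (φ : C(K, ℝ)) (x : K) : scalarFunction 𝕜 φ x = (φ x : 𝕜) := rfl

theorem exists_subset_card_sum_le_half {ι : Type*} [DecidableEq ι] {B : Finset ι} {k : ℕ}
    (hB : B.card = k + k) {a : ι → ℝ} (ha : ∑ i ∈ B, a i = 1) :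
    ∃ B' ⊆ B, B'.card = k ∧ ∑ i ∈ B', a i ≤ 1 / 2 := by
  obtain ⟨B', hB', hcard⟩ := Finset.exists_subset_card_eq (s := B) (n := k) (by omega)
  have h1 := Finset.sum_sdiff (f := a) hB'
  by_cases h : ∑ i ∈ B', a i ≤ 1 / 2
  · exact ⟨B', hB', hcard, h⟩
  · refine ⟨B \ B', Finset.sdiff_subset, ?_, by linarith⟩
    rw [Finset.card_sdiff_of_subset hB']
    omega

/-- Each step halves `B` and gains 1/4. The neighbourhood `V` on which every `g i` vanishes leaves
room for the next correction without increasing the sup norms. -/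
theorem IsClosedJigsaw.exists_large_value {𝕜 : Type v} [RCLike 𝕜] {K : Type u}
    [TopologicalSpace K] [CompactSpace K] [T2Space K] {n : ℕ} {F : Fin n → Set K}
    (hF : IsClosedJigsaw F) (P : Fin n → C(K, 𝕜) →ₗ[𝕜] C(K, 𝕜))
    (hsum : ∀ f, ∑ i, P i f = f) (hsupp : ∀ i f, (∀ x ∈ F i, f x = 0) → P i f = 0)
    {m : ℕ} (hm : 2 ≤ m) (hn : n = 2 ^ m) {j : ℕ} (hj : j ≤ m) :
    ∃ (B : Finset (Fin n)) (x : K) (V : Set K) (g : Fin n → C(K, 𝕜)),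
      B.card = 2 ^ (m - j) ∧ x ∈ exactPoints F B ∧ IsOpen V ∧ x ∈ V ∧
      (∀ i y, ‖g i y‖ ≤ 1) ∧ (∀ i, ∀ y ∈ V, g i y = 0) ∧
      (j / 4 : ℝ) ≤ RCLike.re ((∑ i, P i (g i)) x) := by
  induction j with
  | zero =>
    obtain ⟨x, hx⟩ := hF.nonempty
    refine ⟨Finset.univ, x, Set.univ, 0, by simp [hn], fun i => ?_, isOpen_univ, trivial,
      by simp, by simp, by simp⟩
    simpa using Set.mem_iInter.1 hx i
  | succ j ih =>
    obtain ⟨B, x, V, g, hB, hx, hV, hxV, hg1, hgV, hval⟩ := ih (by omega)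
    have hV0 : IsOpen (V ∩ ⋂ i ∈ Bᶜ, (F i)ᶜ) :=
      hV.inter (isOpen_biInter_finset fun i _ => (hF.isClosed i).isOpen_compl)
    have hxV0 : x ∈ V ∩ ⋂ i ∈ Bᶜ, (F i)ᶜ := by
      refine ⟨hxV, ?_⟩
      simp only [Set.mem_iInter, Finset.mem_compl, Set.mem_compl_iff]
      exact fun i hi h => hi ((hx i).1 h)
    obtain ⟨φ, N, hN, hxN, hNV, hφN, hφV, hφ⟩ := exists_bump hV0 hxV0
    set u := scalarFunction 𝕜 φ with hu
    have hPu : ∀ i ∉ B, P i u = 0 := by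
      refine fun i hi => hsupp i u fun y hy => ?_
      rw [hu, scalarFunction_apply, hφV, RCLike.ofReal_zero]
      rintro ⟨-, h⟩
      simp only [Set.mem_iInter, Finset.mem_compl, Set.mem_compl_iff] at h
      exact h i hi hy
    have hval1 : ∑ i ∈ B, RCLike.re (P i u x) = 1 := by
      rw [Finset.sum_subset (Finset.subset_univ B) fun i _ hi => by simp [hPu i hi], ← map_sum,
        ← ContinuousMap.sum_apply, hsum, hu, scalarFunction_apply, hφN x hxN]
      simp
    have h2 : 2 ^ (m - j) = 2 ^ (m - (j + 1)) + 2 ^ (m - (j + 1)) := by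
      rw [← two_mul, ← pow_succ']
      congr 1
      omega
    obtain ⟨B', hB'B, hB', hhalf⟩ := exists_subset_card_sum_le_half (hB.trans h2) hval1
    -- Since `B'` has at most `2 ^ (m - 1)` elements, `2 ≤ m` leaves at least two indices outside
    -- it.
    have hcard : B'.card + 2 ≤ n := by
      have h3 : 2 ^ (m - (j + 1)) ≤ 2 ^ (m - 1) := Nat.pow_le_pow_right two_pos (by omega)
      have h4 : 2 ^ m = 2 ^ (m - 1) + 2 ^ (m - 1) := by
        rw [← two_mul, ← pow_succ']
        congr 1
        omega
      have h5 : 2 ^ 1 ≤ 2 ^ (m - 1) := Nat.pow_le_pow_right two_pos (by omega)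
      omega
    have hB'ne : B'.Nonempty := Finset.card_pos.1 (by rw [hB']; positivity)
    -- Moving from `x` to `y` may lose 1/8 in each of the two quantities; the net gain is then `1 -
    -- 5/8 - 1/8 = 1/4`.
    let W : Set K := N ∩ ({y | ∑ i ∈ B', RCLike.re (P i u y) < 5 / 8} ∩
      {y | (j / 4 - 1 / 8 : ℝ) < RCLike.re ((∑ i, P i (g i)) y)})
    have hW : IsOpen W := by
      refine hN.inter (IsOpen.inter (isOpen_lt ?_ continuous_const)
        (isOpen_lt continuous_const ?_))
      · exact continuous_finsetSum _ fun i _ => RCLike.continuous_re.comp (P i u).continuous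
      · exact RCLike.continuous_re.comp (ContinuousMap.continuous _)
    have hxW : x ∈ W := ⟨hxN, by simp only [Set.mem_ofPred_eq]; linarith,
      by simp only [Set.mem_ofPred_eq]; linarith⟩
    obtain ⟨y, hyW, hy⟩ := hF.exists_mem_exactPoints hB'ne hcard hW hxW
      fun i hi => (hx i).2 (hB'B hi)
    obtain ⟨hyN, hy1, hy2⟩ := hyW
    simp only [Set.mem_ofPred_eq] at hy1 hy2
    have hV1 : IsOpen (N ∩ ⋂ i ∈ B'ᶜ, (F i)ᶜ) :=
      hN.inter (isOpen_biInter_finset fun i _ => (hF.isClosed i).isOpen_compl)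
    have hyV1 : y ∈ N ∩ ⋂ i ∈ B'ᶜ, (F i)ᶜ := by
      refine ⟨hyN, ?_⟩
      simp only [Set.mem_iInter, Finset.mem_compl, Set.mem_compl_iff]
      exact fun i hi h => hi ((hy i).1 h)
    obtain ⟨ψ, N', hN', hyN', hN'V, hψN, hψV, hψ⟩ := exists_bump hV1 hyV1
    set w := scalarFunction 𝕜 ψ with hw
    have hPw : ∀ i ∉ B', P i w = 0 := by
      refine fun i hi => hsupp i w fun y hy => ?_
      rw [hw, scalarFunction_apply, hψV, RCLike.ofReal_zero]
      rintro ⟨-, h⟩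
      simp only [Set.mem_iInter, Finset.mem_compl, Set.mem_compl_iff] at h
      exact h i hi hy
    have hval2 : ∑ i ∈ B', RCLike.re (P i w y) = 1 := by
      rw [Finset.sum_subset (Finset.subset_univ B') fun i _ hi => by simp [hPw i hi], ← map_sum,
        ← ContinuousMap.sum_apply, hsum, hw, scalarFunction_apply, hψN y hyN']
      simp
    have hdiff : ∀ z, ‖u z - w z‖ ≤ 1 := by
      intro z
      rw [hu, hw, scalarFunction_apply, scalarFunction_apply, ← RCLike.ofReal_sub,
        RCLike.norm_ofReal, abs_le]
      have h3 := hφ z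
      have h4 := hψ z
      exact ⟨by linarith [h3.1, h4.2], by linarith [h3.2, h4.1]⟩
    have hoff : ∀ z ∉ V, u z - w z = 0 := by
      intro z hz
      rw [hu, hw, scalarFunction_apply, scalarFunction_apply, hφV z fun h => hz h.1,
        hψV z fun h => hz (hNV h.1).1, sub_self]
    -- The functions `g i` and `u - w` have disjoint supports: the former vanishes on `V`, the
    -- latter off `V`. On `N'` both bumps equal 1, so the new functions vanish there.
    refine ⟨B', y, N', fun i => if i ∈ B' then g i - (u - w) else g i, hB', hy, hN', hyN', ?_, ?_, ?_⟩
    · intro i z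
      dsimp only
      split_ifs
      · by_cases hz : z ∈ V
        · simpa [hgV i z hz, norm_sub_rev] using hdiff z
        · simpa [hoff z hz] using hg1 i z
      · exact hg1 i z
    · intro i z hz
      have hzN : z ∈ N := (hN'V hz).1
      have hg0 := hgV i z (hNV hzN).1
      dsimp only
      split_ifs
      · simp [hg0, hu, hw, scalarFunction_apply, hφN z hzN, hψN z hz]
      · exact hg0
    · have h3 : ∀ i, P i (if i ∈ B' then g i - (u - w) else g i) =
          P i (g i) - if i ∈ B' then P i u - P i w else 0 := by
        intro i
        split_ifs <;> simp
      have h4 : RCLike.re ((∑ i, P i (if i ∈ B' then g i - (u - w) else g i)) y) =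
          RCLike.re ((∑ i, P i (g i)) y) -
            (∑ i ∈ B', RCLike.re (P i u y) - ∑ i ∈ B', RCLike.re (P i w y)) := by
        simp only [h3, Finset.sum_sub_distrib, Finset.sum_ite_mem, Finset.univ_inter,
          ContinuousMap.sub_apply, ContinuousMap.sum_apply, map_sub, map_sum]
      rw [h4, hval2]
      push_cast
      linarith

end ClosedJigsaw

/-! ### The superspace of `C(K)`. -/

section JigsawCover

variable {K : Type u}

/-- The disjoint unions of the members of the covers `F n`, all glued together over `K`. -/
def jigsawCover (F : ∀ n, Fin (n + 1) → Set K) : Set (K × ∀ n : ℕ, Fin (n + 1)) :=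
  {p | ∀ n, p.1 ∈ F n (p.2 n)}

variable [TopologicalSpace K] {F : ∀ n, Fin (n + 1) → Set K}

theorem isClosed_jigsawCover (hF : ∀ n i, IsClosed (F n i)) : IsClosed (jigsawCover F) := by
  have h : jigsawCover F = ⋂ n, ⋃ i, {p | p.2 n = i} ∩ {p | p.1 ∈ F n i} := by
    ext p
    simp [jigsawCover]
  rw [h]
  refine isClosed_iInter fun n => isClosed_iUnion_of_finite fun i => IsClosed.inter ?_ ?_
  · exact isClosed_eq ((continuous_apply n).comp continuous_snd) continuous_const
  · exact (hF n i).preimage continuous_fst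

/-- The projection of the cover onto `K`. -/
def jigsawCover.proj (F : ∀ n, Fin (n + 1) → Set K) : C(jigsawCover F, K) :=
  ⟨fun p => p.1.1, by fun_prop⟩

theorem jigsawCover.proj_surjective (hF : ∀ n, (⋃ i, F n i) = Set.univ) :
    Function.Surjective (jigsawCover.proj F) := by
  intro x
  have h : ∀ n, ∃ i, x ∈ F n i := fun n => by
    have h1 : x ∈ ⋃ i, F n i := hF n ▸ Set.mem_univ x
    simpa using h1
  choose s hs using h
  exact ⟨⟨(x, s), hs⟩, rfl⟩

variable (𝕜 : Type v) [RCLike 𝕜]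

/-- The indicator of the sheet `i` of the cover with index `n`. -/
def jigsawCover.sheet (F : ∀ n, Fin (n + 1) → Set K) (n : ℕ) (i : Fin (n + 1)) :
    C(jigsawCover F, 𝕜) :=
  ⟨fun p => if p.1.2 n = i then 1 else 0,
    (continuous_of_discreteTopology (f := fun j : Fin (n + 1) => if j = i then (1 : 𝕜) else 0)).comp
      ((continuous_apply n).comp (continuous_snd.comp continuous_subtype_val))⟩

/-- The lift of a function on `K` to the sheet `i` of the cover with index `n`. -/
def jigsawCover.lift (F : ∀ n, Fin (n + 1) → Set K) (n : ℕ) (i : Fin (n + 1)) :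
    C(K, 𝕜) →ₗ[𝕜] C(jigsawCover F, 𝕜) where
  toFun f := f.comp (jigsawCover.proj F) * jigsawCover.sheet 𝕜 F n i
  map_add' f g := by
    ext p
    simp [add_mul]
  map_smul' c f := by
    ext p
    simp

variable {𝕜}

theorem jigsawCover.lift_apply (n : ℕ) (i : Fin (n + 1)) (f : C(K, 𝕜)) (p : jigsawCover F) :
    jigsawCover.lift 𝕜 F n i f p = if p.1.2 n = i then f p.1.1 else 0 := by
  simp [jigsawCover.lift, jigsawCover.sheet, jigsawCover.proj]

theorem jigsawCover.continuous_lift [CompactSpace (jigsawCover F)] (n : ℕ) (i : Fin (n + 1)) :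
    Continuous (jigsawCover.lift 𝕜 F n i) :=
  (ContinuousMap.continuous_precomp (jigsawCover.proj F)).mul continuous_const

theorem jigsawCover.sum_lift (n : ℕ) (f : C(K, 𝕜)) :
    ∑ i, jigsawCover.lift 𝕜 F n i f = f.comp (jigsawCover.proj F) := by
  ext p
  simp [jigsawCover.lift_apply, jigsawCover.proj]

variable (𝕜) in
/-- The closed linear span of the lifts of the functions on `K`. -/
def jigsawSpan (F : ∀ n, Fin (n + 1) → Set K) [CompactSpace (jigsawCover F)] :
    Submodule 𝕜 C(jigsawCover F, 𝕜) :=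
  (Submodule.span 𝕜 (⋃ σ : Σ n, Fin (n + 1),
    Set.range (jigsawCover.lift 𝕜 F σ.1 σ.2))).topologicalClosure

theorem lift_mem_jigsawSpan [CompactSpace (jigsawCover F)] (n : ℕ) (i : Fin (n + 1))
    (f : C(K, 𝕜)) : jigsawCover.lift 𝕜 F n i f ∈ jigsawSpan 𝕜 F :=
  Submodule.le_topologicalClosure _
    (Submodule.subset_span (Set.mem_iUnion.2 ⟨⟨n, i⟩, f, rfl⟩))

theorem comp_proj_mem_jigsawSpan [CompactSpace (jigsawCover F)] (f : C(K, 𝕜)) :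
    f.comp (jigsawCover.proj F) ∈ jigsawSpan 𝕜 F := by
  rw [← jigsawCover.sum_lift 0 f]
  exact Submodule.sum_mem _ fun i _ => lift_mem_jigsawSpan 0 i f

theorem norm_comp_of_surjective {L : Type*} [TopologicalSpace L] [CompactSpace L]
    [CompactSpace K] {π : C(L, K)} (hπ : Function.Surjective π) (f : C(K, 𝕜)) :
    ‖f.comp π‖ = ‖f‖ := by
  refine le_antisymm ((ContinuousMap.norm_le _ (norm_nonneg _)).2 fun p => f.norm_coe_le_norm _)
    ((ContinuousMap.norm_le _ (norm_nonneg _)).2 fun x => ?_)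
  obtain ⟨p, rfl⟩ := hπ x
  exact (f.comp π).norm_coe_le_norm p

variable (𝕜) in
/-- The embedding of the functions on `K` into the span of their lifts. -/
def jigsawEmbedding [CompactSpace K] (F : ∀ n, Fin (n + 1) → Set K)
    [CompactSpace (jigsawCover F)] (hF : ∀ n, (⋃ i, F n i) = Set.univ) :
    C(K, 𝕜) →ₗᵢ[𝕜] jigsawSpan 𝕜 F where
  toFun f := ⟨f.comp (jigsawCover.proj F), comp_proj_mem_jigsawSpan f⟩
  map_add' _ _ := rfl
  map_smul' _ _ := rfl
  norm_map' f := norm_comp_of_surjective (jigsawCover.proj_surjective hF) f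

theorem sum_lift_eq_jigsawEmbedding [CompactSpace K] [CompactSpace (jigsawCover F)]
    (hF : ∀ n, (⋃ i, F n i) = Set.univ) (n : ℕ) (f : C(K, 𝕜)) :
    ∑ i, (⟨_, lift_mem_jigsawSpan n i f⟩ : jigsawSpan 𝕜 F) = jigsawEmbedding 𝕜 F hF f := by
  ext1
  rw [AddSubmonoidClass.coe_finsetSum]
  exact jigsawCover.sum_lift n f

/-- The lifts are continuous and countably many, so lifting only a dense subset `D` of `C(K)` gives
the same closed span, generated by at most `ℵ₀ * #D` functions. -/
theorem densityCharacter_jigsawSpan [CompactSpace K] [Nonempty K] [CompactSpace (jigsawCover F)]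
    (hF : ∀ n, (⋃ i, F n i) = Set.univ) :
    densityCharacter (jigsawSpan 𝕜 F) = densityCharacter C(K, 𝕜) := by
  have : Infinite C(K, 𝕜) := Infinite.of_injective (fun c : 𝕜 => ContinuousMap.const K c)
    fun c d h => by simpa using congrArg (fun f : C(K, 𝕜) => f (Classical.arbitrary K)) h
  have : Infinite (jigsawSpan 𝕜 F) :=
    Infinite.of_injective _ (jigsawEmbedding 𝕜 F hF).isometry.injective
  refine le_antisymm ?_ (densityCharacter_mono_of_isometry (jigsawEmbedding 𝕜 F hF).isometry)
  obtain ⟨D, hD, hcard⟩ := exists_dense_card_eq_densityCharacter C(K, 𝕜)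
  let f : (Σ n, Fin (n + 1)) × D → C(jigsawCover F, 𝕜) :=
    fun q => jigsawCover.lift 𝕜 F q.1.1 q.1.2 q.2
  obtain ⟨D', hD', hspan⟩ := exists_card_le_span_subset_closure 𝕜 (Set.range f)
  have h1 : (jigsawSpan 𝕜 F : Set C(jigsawCover F, 𝕜)) ⊆ closure D' := by
    refine closure_minimal ?_ isClosed_closure
    have h2 : Submodule.span 𝕜 (⋃ σ : Σ n, Fin (n + 1),
        Set.range (jigsawCover.lift 𝕜 F σ.1 σ.2)) ≤
        (Submodule.span 𝕜 (Set.range f)).topologicalClosure := by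
      refine Submodule.span_le.2 (Set.iUnion_subset fun σ => ?_)
      rintro _ ⟨g, rfl⟩
      refine map_mem_closure (jigsawCover.continuous_lift σ.1 σ.2) (hD g) fun d hd => ?_
      exact Submodule.subset_span ⟨(σ, ⟨d, hd⟩), rfl⟩
    exact fun x hx => closure_minimal hspan isClosed_closure (h2 hx)
  refine (densityCharacter_le_of_isometry (j := (Subtype.val : jigsawSpan 𝕜 F → C(jigsawCover F, 𝕜)))
    isometry_subtype_coe (by simpa using h1)).trans ?_
  have h3 : #(Set.range f) ≤ max ℵ₀ #D := by
    refine Cardinal.mk_range_le.trans ?_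
    rw [Cardinal.mk_prod, Cardinal.lift_id'.{0, max u v}]
    refine (Cardinal.mul_le_max _ _).trans ?_
    simp
  rw [hcard, max_eq_right (aleph0_le_densityCharacter _)] at h3
  exact max_le (aleph0_le_densityCharacter _)
    (hD'.trans (max_le (aleph0_le_densityCharacter _) h3))

/-- A projection provides a left inverse `R` of the embedding, and composing `R` with the lifts to
the sheets gives the operators of `IsClosedJigsaw.exists_large_value`. The functions `g i` placed on
disjoint sheets form one function of norm at most 1. -/
theorem not_closedComplemented_jigsawEmbedding [CompactSpace K] [T2Space K]
    [CompactSpace (jigsawCover F)] (hF : ∀ n, IsDenseClosedJigsaw (F n)) :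
    ¬ (LinearMap.range (jigsawEmbedding 𝕜 F fun n => (hF n).iUnion_eq).toLinearMap).ClosedComplemented := by
  intro hcompl
  set J := jigsawEmbedding 𝕜 F fun n => (hF n).iUnion_eq with hJ
  obtain ⟨p, hp⟩ := hcompl
  let R : jigsawSpan 𝕜 F →L[𝕜] C(K, 𝕜) :=
    (J.equivRange.symm.toContinuousLinearEquiv : _ →L[𝕜] C(K, 𝕜)).comp p
  have hR : ∀ f, R (J f) = f := by
    intro f
    have h1 : p (J f) = J.equivRange f := hp (J.equivRange f)
    change J.equivRange.symm (p (J f)) = f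
    rw [h1, LinearIsometryEquiv.symm_apply_apply]
  obtain ⟨m, hm⟩ := exists_nat_gt (max 2 (4 * ‖R‖))
  have hm2 : 2 ≤ m := by exact_mod_cast ((le_max_left _ _).trans_lt hm).le
  have hm4 : 4 * ‖R‖ < m := (le_max_right _ _).trans_lt hm
  -- The family with index `k` has `k + 1` members, so the jigsaw of `2 ^ m` sets has index `2 ^ m -
  -- 1`.
  have hn : (2 ^ m - 1) + 1 = 2 ^ m := Nat.sub_add_cancel Nat.one_le_two_pow
  let T : Fin (2 ^ m - 1 + 1) → C(K, 𝕜) →ₗ[𝕜] jigsawSpan 𝕜 F := fun i =>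
    (jigsawCover.lift 𝕜 F (2 ^ m - 1) i).codRestrict _ fun f => lift_mem_jigsawSpan _ i f
  obtain ⟨-, x, -, g, -, -, -, -, hg, -, hval⟩ := (hF (2 ^ m - 1)).exists_large_value
    (fun i => R.toLinearMap ∘ₗ T i)
    (fun f => by
      conv_rhs => rw [← hR f, hJ, ← sum_lift_eq_jigsawEmbedding _ (2 ^ m - 1) f, map_sum]
      rfl)
    (fun i f hf => by
      -- A point on sheet `i` projects into `F i`, where `f` vanishes.
      have h1 : T i f = 0 := by
        ext q
        change jigsawCover.lift 𝕜 F (2 ^ m - 1) i f q = 0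
        rw [jigsawCover.lift_apply]
        split_ifs with h
        · exact hf _ (h ▸ q.2 (2 ^ m - 1))
        · rfl
      simp [h1])
    hm2 hn le_rfl
  have h1 : ‖∑ i, T i (g i)‖ ≤ 1 := by
    change ‖((∑ i, T i (g i) : jigsawSpan 𝕜 F) : C(jigsawCover F, 𝕜))‖ ≤ 1
    refine (ContinuousMap.norm_le _ zero_le_one).2 fun q => ?_
    have h2 : ((∑ i, T i (g i) : jigsawSpan 𝕜 F) : C(jigsawCover F, 𝕜)) q =
        g (q.1.2 (2 ^ m - 1)) q.1.1 := by
      rw [AddSubmonoidClass.coe_finsetSum, ContinuousMap.sum_apply]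
      change ∑ i, jigsawCover.lift 𝕜 F (2 ^ m - 1) i (g i) q = _
      simp [jigsawCover.lift_apply]
    rw [h2]
    exact hg _ _
  have h3 : (m / 4 : ℝ) ≤ ‖R‖ := by
    calc (m / 4 : ℝ) ≤ _ := hval
      _ = RCLike.re (R (∑ i, T i (g i)) x) := by
        rw [map_sum]
        rfl
      _ ≤ ‖R (∑ i, T i (g i)) x‖ := RCLike.re_le_norm _
      _ ≤ ‖R (∑ i, T i (g i))‖ := ContinuousMap.norm_coe_le_norm _ _
      _ ≤ ‖R‖ * ‖∑ i, T i (g i)‖ := R.le_opNorm _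
      _ ≤ ‖R‖ := mul_le_of_le_one_right R.opNorm_nonneg h1
  linarith

variable (𝕜) in
theorem uncomplementedInSuperspace_of_isDenseClosedJigsaw (K : Type u) [TopologicalSpace K]
    [CompactSpace K] [T2Space K]
    (hK : ∀ n : ℕ, 1 ≤ n → ∃ F : Fin n → Set K, IsDenseClosedJigsaw F) :
    UncomplementedInSuperspace 𝕜 C(K, 𝕜) (densityCharacter C(K, 𝕜)) := by
  choose F hF using fun n : ℕ => hK (n + 1) (Nat.le_add_left 1 n)
  have : CompactSpace (jigsawCover F) :=
    isCompact_iff_compactSpace.1 (isClosed_jigsawCover fun n => (hF n).isClosed).isCompact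
  have : Nonempty K := (hF 0).nonempty.to_type
  have : CompleteSpace (jigsawSpan 𝕜 F) :=
    (Submodule.isClosed_topologicalClosure _).completeSpace_coe
  exact ⟨jigsawSpan 𝕜 F, inferInstance, inferInstance, this,
    jigsawEmbedding 𝕜 F fun n => (hF n).iUnion_eq, densityCharacter_jigsawSpan fun n => (hF n).iUnion_eq,
    not_closedComplemented_jigsawEmbedding hF⟩

end JigsawCover

/-! ### Stone duality, and the passage from gaps to closed sets. -/

namespace StoneSpace

variable {𝓑 : Type u} [BooleanAlgebra 𝓑]

theorem notMem_of_inf_eq_bot {U : StoneSpace 𝓑} {a b : 𝓑} (ha : a ∈ U.carrier)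
    (h : a ⊓ b = ⊥) : b ∉ U.carrier :=
  fun hb => U.bot_notMem (h ▸ U.inf_mem ha hb)

theorem compl_mem_iff {U : StoneSpace 𝓑} {a : 𝓑} : aᶜ ∈ U.carrier ↔ a ∉ U.carrier :=
  ⟨fun h => notMem_of_inf_eq_bot h compl_inf_eq_bot, (U.mem_or_compl_mem a).resolve_left⟩

theorem inf_mem_iff {U : StoneSpace 𝓑} {a b : 𝓑} :
    a ⊓ b ∈ U.carrier ↔ a ∈ U.carrier ∧ b ∈ U.carrier :=
  ⟨fun h => ⟨U.mem_of_le h inf_le_left, U.mem_of_le h inf_le_right⟩, fun h => U.inf_mem h.1 h.2⟩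

theorem finset_inf_mem {U : StoneSpace 𝓑} {ι : Type*} {s : Finset ι} {c : ι → 𝓑}
    (h : ∀ i ∈ s, c i ∈ U.carrier) : s.inf c ∈ U.carrier :=
  Finset.inf_induction U.top_mem (fun _ ha _ hb => U.inf_mem ha hb) h

/-- Every element outside an ideal belongs to an ultrafilter disjoint from the ideal. -/
theorem exists_mem_disjoint {J : Order.Ideal 𝓑} {a : 𝓑} (ha : a ∉ J) :
    ∃ U : StoneSpace 𝓑, a ∈ U.carrier ∧ ∀ b ∈ J, b ∉ U.carrier := by
  have hdisj : Disjoint (Order.PFilter.principal a : Set 𝓑) (J : Set 𝓑) :=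
    Set.disjoint_left.2 fun b hb hbJ => ha (J.lower (Order.PFilter.mem_principal.1 hb) hbJ)
  obtain ⟨I, hI, hJI, hdI⟩ := DistribLattice.prime_ideal_of_disjoint_filter_ideal hdisj
  refine ⟨⟨(I : Set 𝓑)ᶜ, ?_, ?_, ?_, ?_, ?_⟩, ?_, ?_⟩
  · exact fun h => hI.toIsProper.top_notMem h
  · exact fun h => h I.bot_mem
  · exact fun ha hab hb => ha (I.lower hab hb)
  · exact fun ha hb hab => (hI.mem_or_mem hab).elim ha hb
  · intro b
    by_contra! h
    obtain ⟨h1, h2⟩ := h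
    simp only [Set.mem_compl_iff, not_not, SetLike.mem_coe] at h1 h2
    exact hI.toIsProper.top_notMem (sup_compl_eq_top (x := b) ▸ I.sup_mem h1 h2)
  · exact Set.disjoint_left.1 hdI (Order.PFilter.mem_principal.2 le_rfl)
  · exact fun b hb h => h (hJI hb)

theorem exists_mem {a : 𝓑} (ha : a ≠ ⊥) : ∃ U : StoneSpace 𝓑, a ∈ U.carrier := by
  obtain ⟨U, hU, -⟩ := exists_mem_disjoint (J := Order.Ideal.principal ⊥) (a := a)
    fun h => ha (le_bot_iff.1 (Order.Ideal.mem_principal.1 h))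
  exact ⟨U, hU⟩

/-- The clopen set of the ultrafilters that contain `a`. -/
def basicOpen (a : 𝓑) : Set (StoneSpace 𝓑) := {U | a ∈ U.carrier}

theorem isTopologicalBasis_basicOpen :
    TopologicalSpace.IsTopologicalBasis (Set.range (basicOpen : 𝓑 → Set (StoneSpace 𝓑))) where
  exists_subset_inter := by
    rintro _ ⟨a, rfl⟩ _ ⟨b, rfl⟩ U hU
    exact ⟨basicOpen (a ⊓ b), ⟨_, rfl⟩, U.inf_mem hU.1 hU.2, fun V hV => inf_mem_iff.1 hV⟩
  sUnion_eq := Set.eq_univ_of_forall fun U => ⟨basicOpen ⊤, ⟨_, rfl⟩, U.top_mem⟩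
  eq_generateFrom := by
    change TopologicalSpace.generateFrom _ = _
    congr 1
    ext s
    exact exists_congr fun a => eq_comm

theorem isClopen_basicOpen (a : 𝓑) : IsClopen (basicOpen a) := by
  have h : ∀ a : 𝓑, IsOpen (basicOpen a) := fun a =>
    isTopologicalBasis_basicOpen.isOpen ⟨a, rfl⟩
  refine ⟨⟨?_⟩, h a⟩
  convert h aᶜ using 1
  ext U
  exact compl_mem_iff.symm

theorem exists_mem_notMem {U V : StoneSpace 𝓑} (h : U ≠ V) : ∃ a, a ∈ U.carrier ∧ a ∉ V.carrier := by
  by_contra! hle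
  refine h (StoneSpace.ext (Set.Subset.antisymm hle fun a ha => ?_))
  by_contra hU
  exact compl_mem_iff.1 (hle _ (compl_mem_iff.2 hU)) ha

instance : T2Space (StoneSpace 𝓑) := by
  refine ⟨fun U V h => ?_⟩
  obtain ⟨a, ha, hb⟩ := exists_mem_notMem h
  exact ⟨basicOpen a, (basicOpen a)ᶜ, (isClopen_basicOpen a).isOpen,
    (isClopen_basicOpen a).compl.isOpen, ha, hb, disjoint_compl_right⟩

theorem basicOpen_injective : Function.Injective (basicOpen : 𝓑 → Set (StoneSpace 𝓑)) := by
  have h : ∀ a b : 𝓑, basicOpen a ⊆ basicOpen b → a ≤ b := by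
    intro a b hab
    rw [← sdiff_eq_bot_iff]
    by_contra hne
    obtain ⟨U, hU⟩ := exists_mem hne
    rw [sdiff_eq, inf_mem_iff, compl_mem_iff] at hU
    exact hU.2 (hab hU.1)
  exact fun a b hab => le_antisymm (h a b hab.le) (h b a hab.ge)

section Gaps

/-- The closed set of the ultrafilters that meet no element orthogonal to the ideal `I`. -/
def hull (I : Order.Ideal 𝓑) : Set (StoneSpace 𝓑) :=
  {U | ∀ c ∈ orthogonalSet (I : Set 𝓑), c ∉ U.carrier}

theorem isClosed_hull (I : Order.Ideal 𝓑) : IsClosed (hull I) := by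
  have h : hull I = ⋂ c ∈ orthogonalSet (I : Set 𝓑), (basicOpen c)ᶜ := by
    ext U
    simp [hull, basicOpen]
  rw [h]
  exact isClosed_biInter fun c _ => (isClopen_basicOpen c).compl.isClosed

/-- The ideal `J` is generated by the orthogonals of the `I i`. If `a ≤ ⋁ d i` with each `d i`
orthogonal to `I i`, then the elements `a ⊓ (d i)ᶜ` separate; otherwise an ultrafilter containing
`a` and avoiding `J` lies in every hull. Conversely, if `c i` bounds `I i` below `a`, then `(c i)ᶜ ⊓
a` is orthogonal to `I i`, which forces `c i` into any ultrafilter of the hulls that contains `a`.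
-/
theorem not_separated_iff {ι : Type*} [Fintype ι] [Nonempty ι] (I : ι → Order.Ideal 𝓑) (a : 𝓑) :
    (∀ c : ι → 𝓑, (∀ i, ∀ b ∈ restrictIdeal (I i) a, b ≤ c i) → Finset.univ.inf c ≠ ⊥) ↔
      ∃ U ∈ basicOpen a, ∀ i, U ∈ hull (I i) := by
  constructor
  · intro h
    let J : Order.Ideal 𝓑 := Order.IsIdeal.toIdeal (I := {x | ∃ d : ι → 𝓑,
        (∀ i, d i ∈ orthogonalSet (I i : Set 𝓑)) ∧ x ≤ Finset.univ.sup d})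
      { IsLowerSet := by
          rintro x y hyx ⟨d, hd, hx⟩
          exact ⟨d, hd, hyx.trans hx⟩
        Nonempty := ⟨⊥, fun _ => ⊥, fun i a _ => inf_bot_eq a, bot_le⟩
        Directed := by
          rintro x ⟨d, hd, hx⟩ y ⟨e, he, hy⟩
          refine ⟨x ⊔ y, ⟨fun i => d i ⊔ e i, fun i a ha => ?_, ?_⟩, le_sup_left, le_sup_right⟩
          · rw [inf_sup_left, hd i a ha, he i a ha, sup_bot_eq]
          · exact sup_le (hx.trans (Finset.sup_mono_fun fun i _ => le_sup_left))
              (hy.trans (Finset.sup_mono_fun fun i _ => le_sup_right)) }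
    have ha : a ∉ J := by
      rintro ⟨d, hd, had⟩
      refine h (fun i => a ⊓ (d i)ᶜ) (fun i b hb => ?_) ?_
      · rw [mem_restrictIdeal] at hb
        exact le_inf hb.2 (le_compl_iff_disjoint_right.2 (disjoint_iff.2 (hd i b hb.1)))
      · rw [eq_bot_iff]
        have h1 : Finset.univ.inf (fun i => a ⊓ (d i)ᶜ) ≤ a :=
          (Finset.inf_le (Finset.mem_univ (Classical.arbitrary ι))).trans inf_le_left
        have h2 : Finset.univ.inf (fun i => a ⊓ (d i)ᶜ) ≤ (Finset.univ.sup d)ᶜ := by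
          rw [Finset.compl_sup]
          exact Finset.inf_mono_fun fun i _ => inf_le_right
        exact (le_inf (h1.trans had) h2).trans inf_compl_eq_bot.le
    obtain ⟨U, hU, hUJ⟩ := exists_mem_disjoint ha
    refine ⟨U, hU, fun i c hc => hUJ c ?_⟩
    classical
    refine ⟨fun j => if j = i then c else ⊥, fun j => ?_, ?_⟩
    · dsimp only
      split_ifs with hj
      · exact hj ▸ hc
      · exact fun b _ => inf_bot_eq b
    · exact (le_of_eq (if_pos rfl).symm).trans
        (Finset.le_sup (f := fun j => if j = i then c else ⊥) (Finset.mem_univ i))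
  · rintro ⟨U, hU, hUI⟩ c hc hbot
    refine U.bot_notMem (hbot ▸ finset_inf_mem fun i _ => ?_)
    have h1 : (c i)ᶜ ⊓ a ∈ orthogonalSet (I i : Set 𝓑) := by
      intro b hb
      have h2 : b ⊓ a ≤ c i := hc i _ (mem_restrictIdeal.2 ⟨(I i).lower inf_le_left hb, inf_le_right⟩)
      rw [inf_comm (c i)ᶜ a, ← inf_assoc, ← le_bot_iff]
      exact (inf_le_inf_right _ h2).trans inf_compl_eq_bot.le
    by_contra hci
    exact hUI i _ h1 (U.inf_mem (compl_mem_iff.2 hci) hU)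

theorem isMultipleGap_restrict_iff {ι : Type*} [Fintype ι] [Nonempty ι] {I : ι → Order.Ideal 𝓑}
    (hI : ∀ i j, i ≠ j → ∀ a ∈ I i, ∀ b ∈ I j, a ⊓ b = ⊥) (a : 𝓑) :
    IsMultipleGap (fun i => restrictIdeal (I i) a) ↔ ∃ U ∈ basicOpen a, ∀ i, U ∈ hull (I i) := by
  rw [← not_separated_iff]
  exact ⟨fun h => h.not_separated, fun h => ⟨fun i j hij x hx y hy =>
    hI i j hij x (mem_restrictIdeal.1 hx).1 y (mem_restrictIdeal.1 hy).1, h⟩⟩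

/-- If the hulls of `A` meet inside the clopen set of `a`, the algebraic jigsaw condition yields `b
≤ a` whose clopen set contains a common point of the hulls of `B` and misses those of `A \ B`; if
they do not meet there, the given point already works. For the covering, an ultrafilter outside all
hulls would contain a meet orthogonal to every `I i`, which density makes zero. -/
theorem isDenseClosedJigsaw_hull {n : ℕ} (hn : 1 ≤ n) {I : Fin n → Order.Ideal 𝓑}
    (hI : IsDenseJigsaw I) : IsDenseClosedJigsaw fun i => hull (I i) where
  isClosed i := isClosed_hull _
  nonempty := by
    have : Nonempty (Fin n) := ⟨⟨0, hn⟩⟩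
    obtain ⟨U, -, hU⟩ := (not_separated_iff I ⊤).1 fun c hc =>
      hI.not_separated c fun i b hb => hc i b (mem_restrictIdeal.2 ⟨hb, le_top⟩)
    exact ⟨U, Set.mem_iInter.2 hU⟩
  dense := by
    classical
    intro A B hB hBA hA U hU
    rw [isTopologicalBasis_basicOpen.mem_closure_iff]
    rintro _ ⟨a, rfl⟩ ha
    by_cases hne : ∃ V ∈ basicOpen a, ∀ i ∈ A, V ∈ hull (I i)
    · obtain ⟨V, hVa, hV⟩ := hne
      obtain ⟨i₀, hi₀⟩ := hB
      have hAne : Nonempty A.toFinset := ⟨⟨i₀, by simpa using hBA.1 hi₀⟩⟩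
      have hBne : Nonempty B.toFinset := ⟨⟨i₀, by simpa using hi₀⟩⟩
      have hBuniv : B.toFinset ≠ Finset.univ := by
        rw [Ne, Set.toFinset_eq_univ]
        rintro rfl
        exact hBA.2 (Set.subset_univ _)
      have hgap := (isMultipleGap_restrict_iff (I := fun i : A.toFinset => I i)
        (fun i j hij => hI.orthogonal i j (Subtype.coe_injective.ne hij)) a).2
        ⟨V, hVa, fun i => hV i (Set.mem_toFinset.1 i.2)⟩
      obtain ⟨b, hba, hb, hbA⟩ := hI.jigsaw B.toFinset ⟨i₀, by simpa using hi₀⟩ hBuniv A.toFinset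
        (Set.toFinset_mono hBA.1) a hgap
      obtain ⟨W, hWb, hW⟩ := (isMultipleGap_restrict_iff (I := fun i : B.toFinset => I i)
        (fun i j hij => hI.orthogonal i j (Subtype.coe_injective.ne hij)) b).1 hb
      refine ⟨W, W.mem_of_le hWb hba, ?_, ?_⟩
      · exact Set.mem_iInter₂.2 fun i hi => hW ⟨i, by simpa using hi⟩
      · obtain ⟨j, hjA, hjB⟩ := Set.exists_of_ssubset hBA
        exact fun h => Set.mem_iInter₂.1 h j hjA b (hbA j (by simp [hjA, hjB])) hWb
    · refine ⟨U, ha, hU, fun h => hne ⟨U, ha, fun i hi => Set.mem_iInter₂.1 h i hi⟩⟩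
  iUnion_eq := by
    refine Set.eq_univ_of_forall fun U => ?_
    by_contra hU
    simp only [hull, Set.mem_iUnion, Set.mem_ofPred_eq, not_exists, not_forall, not_not] at hU
    choose c hc hcU using hU
    have h1 : Finset.univ.inf c ∈
        orthogonalSet {x : 𝓑 | ∃ f : Fin n → 𝓑, (∀ i, f i ∈ I i) ∧ x = Finset.univ.sup f} := by
      rintro _ ⟨f, hf, rfl⟩
      rw [← disjoint_iff, Finset.disjoint_sup_left]
      intro i _
      exact (disjoint_iff.2 (hc i _ (hf i))).mono_right (Finset.inf_le (Finset.mem_univ i))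
    rw [hI.dense] at h1
    exact U.bot_notMem (h1 ▸ finset_inf_mem fun i _ => hcU i)

end Gaps

end StoneSpace

/-- In a finite algebra ideals have greatest elements, and those of two orthogonal ideals separate
them, so there is no 2-gap. -/
theorem HasDenseJigsaws.infinite {𝓑 : Type u} [BooleanAlgebra 𝓑] (h : HasDenseJigsaws 𝓑) :
    Infinite 𝓑 := by
  rw [← not_finite_iff_infinite]
  intro hfin
  obtain ⟨I, hI⟩ := h 2 one_le_two
  have hmax : ∀ i, ∃ m ∈ I i, ∀ a ∈ I i, a ≤ m := by
    intro i
    have hs := Set.toFinite (I i : Set 𝓑)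
    refine ⟨hs.toFinset.sup id, ?_, fun a ha => Finset.le_sup (f := id) (by simpa using ha)⟩
    exact Finset.sup_induction (p := fun x => x ∈ I i) (I i).bot_mem
      (fun x hx y hy => (I i).sup_mem hx hy) fun x hx => by simpa using hx
  choose m hm hle using hmax
  refine hI.not_separated m hle (eq_bot_iff.2 ?_)
  rw [← hI.orthogonal 0 1 (by simp) _ (hm 0) _ (hm 1)]
  exact le_inf (Finset.inf_le (Finset.mem_univ _)) (Finset.inf_le (Finset.mem_univ _))

/-! ### Jigsaws of ideals of sets of natural numbers -/

section SetJigsaw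

/-- The column of `s` over `k`, under the pairing bijection. -/
def natColumn (k : ℕ) (s : Set ℕ) : Set ℕ := {m | Nat.pair k m ∈ s}

/-- The set with the given columns. -/
def ofColumns (t : ℕ → Set ℕ) : Set ℕ := {p | p.unpair.2 ∈ t p.unpair.1}

@[simp] theorem natColumn_ofColumns (k : ℕ) (t : ℕ → Set ℕ) : natColumn k (ofColumns t) = t k := by
  ext m
  simp [natColumn, ofColumns]

theorem mem_iff_mem_natColumn {s : Set ℕ} {p : ℕ} : p ∈ s ↔ p.unpair.2 ∈ natColumn p.unpair.1 s := by
  simp [natColumn]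

theorem subset_iff_natColumn {s t : Set ℕ} : s ⊆ t ↔ ∀ k, natColumn k s ⊆ natColumn k t :=
  ⟨fun h _ _ hm => h hm, fun h _ hp => mem_iff_mem_natColumn.2 (h _ (mem_iff_mem_natColumn.1 hp))⟩

theorem natColumn_mono (k : ℕ) {s t : Set ℕ} (h : s ⊆ t) : natColumn k s ⊆ natColumn k t :=
  subset_iff_natColumn.1 h k

theorem natColumn_diff (k : ℕ) (s t : Set ℕ) :
    natColumn k (s \ t) = natColumn k s \ natColumn k t := rfl

theorem finite_natColumn {s : Set ℕ} (hs : s.Finite) (k : ℕ) : (natColumn k s).Finite :=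
  hs.preimage fun _ _ _ _ h => (Nat.pair_eq_pair.1 h).2

theorem finite_nonempty_natColumn {s : Set ℕ} (hs : s.Finite) :
    {k | (natColumn k s).Nonempty}.Finite := by
  refine (hs.image fun p => p.unpair.1).subset ?_
  rintro k ⟨m, hm⟩
  exact ⟨Nat.pair k m, hm, by simp⟩

theorem finite_of_natColumn {s : Set ℕ} (h : {k | (natColumn k s).Nonempty}.Finite)
    (h' : ∀ k, (natColumn k s).Finite) : s.Finite := by
  refine (h.biUnion fun k _ => (h' k).image (Nat.pair k)).subset fun p hp => ?_
  have h1 := mem_iff_mem_natColumn.1 hp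
  exact Set.mem_biUnion (show p.unpair.1 ∈ _ from ⟨_, h1⟩) ⟨_, h1, Nat.pair_unpair p⟩

/-- The ideals `I i`, `i ∈ A`, restricted to `a`, cannot be separated by sets with empty
intersection. -/
def IsSetGap {n : ℕ} (I : Fin n → Set ℕ → Prop) (A : Finset (Fin n)) (a : Set ℕ) : Prop :=
  ∀ c : Fin n → Set ℕ, (∀ i ∈ A, ∀ s ⊆ a, I i s → (s \ c i).Finite) → ∃ p, ∀ i ∈ A, p ∈ c i

/-- A dense jigsaw of ideals of sets of natural numbers that contain the finite sets. -/
structure IsSetJigsaw {n : ℕ} (I : Fin n → Set ℕ → Prop) : Prop where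
  subset : ∀ i s t, I i t → s ⊆ t → I i s
  union : ∀ i s t, I i s → I i t → I i (s ∪ t)
  finite : ∀ i s, s.Finite → I i s
  orthogonal : ∀ i j, i ≠ j → ∀ s t, I i s → I j t → (s ∩ t).Finite
  dense : ∀ s : Set ℕ, s.Infinite → ∃ i, ∃ t ⊆ s, t.Infinite ∧ I i t
  gap : IsSetGap I Finset.univ Set.univ
  jigsaw : ∀ A B : Finset (Fin n), B.Nonempty → B ⊆ A → ∀ a, IsSetGap I A a →
    ∃ b ⊆ a, IsSetGap I B b ∧ ∀ i ∈ A \ B, ∀ s ⊆ b, I i s → s.Finite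

variable {n : ℕ} {I : Fin n → Set ℕ → Prop}

theorem IsSetGap.exists_mem {A : Finset (Fin n)} {a : Set ℕ} (h : IsSetGap I A a)
    (hA : A.Nonempty) {c : Fin n → Set ℕ}
    (hc : ∀ i ∈ A, ∀ s ⊆ a, I i s → (s \ c i).Finite) : ∃ p ∈ a, ∀ i ∈ A, p ∈ c i := by
  obtain ⟨p, hp⟩ := h (fun i => c i ∩ a) fun i hi s hs hIs => by
    refine (hc i hi s hs hIs).subset ?_
    rintro q ⟨hqs, hq⟩
    exact ⟨hqs, fun h => hq ⟨h, hs hqs⟩⟩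
  obtain ⟨i, hi⟩ := hA
  exact ⟨p, (hp i hi).2, fun j hj => (hp j hj).1⟩

/-- Separators matter only up to finite sets: a finite common part could be deleted from each of
them, leaving no common point. -/
theorem IsSetGap.infinite {A : Finset (Fin n)} {a : Set ℕ} (h : IsSetGap I A a)
    (hA : A.Nonempty) {c : Fin n → Set ℕ}
    (hc : ∀ i ∈ A, ∀ s ⊆ a, I i s → (s \ c i).Finite) : {p | ∀ i ∈ A, p ∈ c i}.Infinite := by
  intro hfin
  obtain ⟨p, -, hp⟩ := h.exists_mem hA (c := fun i => c i \ {p | ∀ i ∈ A, p ∈ c i})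
    fun i hi s hs hIs => by
      refine ((hc i hi s hs hIs).union hfin).subset ?_
      rintro q ⟨hqs, hq⟩
      by_cases h : q ∈ c i
      · exact Or.inr (by_contra fun h' => hq ⟨h, h'⟩)
      · exact Or.inl ⟨hqs, h⟩
  obtain ⟨i, hi⟩ := hA
  exact (hp i hi).2 fun j hj => (hp j hj).1

/-- Otherwise `∅` for the index `i` and `Set.univ` for the others would separate. -/
theorem IsSetGap.exists_infinite {A : Finset (Fin n)} {a : Set ℕ} (h : IsSetGap I A a)
    {i : Fin n} (hi : i ∈ A) : ∃ s ⊆ a, s.Infinite ∧ I i s := by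
  by_contra! hne
  obtain ⟨p, hp⟩ := h (fun j => if j = i then ∅ else Set.univ) fun j _ s hs hIs => by
    split_ifs with hji
    · subst hji
      rw [Set.sdiff_empty]
      by_contra hinf
      exact hne s hs hinf hIs
    · simp
  simpa using hp i hi

/-- The ideals of a jigsaw with one more index: the sets with finite columns, and the sets
contained in finitely many columns that belong to an ideal of the old jigsaw. -/
def succIdeals (I : Fin n → Set ℕ → Prop) : Fin (n + 1) → Set ℕ → Prop :=
  Fin.cons (fun s => ∀ k, (natColumn k s).Finite)
    fun i s => {k | (natColumn k s).Nonempty}.Finite ∧ ∀ k, I i (natColumn k s)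

theorem succIdeals_zero {s : Set ℕ} : succIdeals I 0 s ↔ ∀ k, (natColumn k s).Finite := Iff.rfl

theorem succIdeals_succ {i : Fin n} {s : Set ℕ} : succIdeals I i.succ s ↔
    {k | (natColumn k s).Nonempty}.Finite ∧ ∀ k, I i (natColumn k s) := Iff.rfl

/-- The indices of the old jigsaw that belong to a set of indices of the new one. -/
def predIndices (A : Finset (Fin (n + 1))) : Finset (Fin n) := {i | i.succ ∈ A}

@[simp] theorem mem_predIndices {A : Finset (Fin (n + 1))} {i : Fin n} :
    i ∈ predIndices A ↔ i.succ ∈ A := by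
  simp [predIndices]

/-- Finitely many columns can be discarded from a gap if the new index is involved, and otherwise
some column is a gap. -/
theorem exists_isSetGap_natColumn {A : Finset (Fin (n + 1))} {a : Set ℕ} (h : IsSetGap (succIdeals I) A a)
    {F : Set ℕ} (hF : F.Finite) (hFA : 0 ∉ A → F = ∅) :
    ∃ k ∉ F, IsSetGap I (predIndices A) (natColumn k a) := by
  classical
  by_contra! hne
  have hc : ∀ k, ∃ c : Fin n → Set ℕ, k ∉ F →
      (∀ i ∈ predIndices A, ∀ s ⊆ natColumn k a, I i s → (s \ c i).Finite) ∧
        ∀ p, ∃ i ∈ predIndices A, p ∉ c i := by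
    intro k
    by_cases hk : k ∈ F
    · exact ⟨fun _ => ∅, fun h => (h hk).elim⟩
    · have h1 := hne k hk
      simp only [IsSetGap, not_forall, not_exists] at h1
      obtain ⟨c, hc, hc'⟩ := h1
      exact ⟨c, fun _ => ⟨hc, fun p => by simpa using hc' p⟩⟩
  choose c hc using hc
  -- Separators of the single columns are assembled into one family. A set with finite columns meets
  -- the finitely many columns of `F` in a finite set, so the new index is separated by their
  -- complement.
  obtain ⟨p, hp⟩ := h (Fin.cons {p | p.unpair.1 ∉ F}
      fun i => ofColumns fun k => if k ∈ F then Set.univ else c k i) fun i => by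
    refine Fin.cases (fun hi s hs hIs => ?_) (fun i hi s hs hIs => ?_) i
    · refine finite_of_natColumn (hF.subset ?_)
        fun k => (hIs k).subset (natColumn_mono k Set.sdiff_subset)
      rintro k ⟨m, -, hm⟩
      simpa using hm
    · rw [succIdeals_succ] at hIs
      refine finite_of_natColumn (hIs.1.subset fun k hk => hk.mono
        (natColumn_mono k Set.sdiff_subset)) fun k => ?_
      rw [natColumn_diff, Fin.cons_succ, natColumn_ofColumns]
      split_ifs with hk
      · simp
      · exact (hc k hk).1 i (by simpa using hi) _ (natColumn_mono k hs) (hIs.2 k)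
  have hpF : p.unpair.1 ∉ F := by
    by_cases h0 : 0 ∈ A
    · simpa using hp 0 h0
    · simp [hFA h0]
  obtain ⟨i, hi, hpi⟩ := (hc _ hpF).2 p.unpair.2
  have h1 := hp i.succ (by simpa using hi)
  simp only [Fin.cons_succ, ofColumns, Set.mem_ofPred_eq, hpF, if_false] at h1
  exact hpi h1

theorem infinite_isSetGap_natColumn {A : Finset (Fin (n + 1))} (h0 : 0 ∈ A) {a : Set ℕ}
    (h : IsSetGap (succIdeals I) A a) :
    {k | IsSetGap I (predIndices A) (natColumn k a)}.Infinite := by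
  intro hfin
  obtain ⟨k, hk, hk'⟩ := exists_isSetGap_natColumn h hfin fun h => (h h0).elim
  exact hk hk'

/-- A separator of the new ideals restricts to a separator of the old ideals on each column. -/
theorem finite_diff_natColumn (hempty : ∀ i, I i ∅) {i : Fin n} {a c : Set ℕ} (k : ℕ)
    (hc : ∀ s ⊆ a, succIdeals I i.succ s → (s \ c).Finite) :
    ∀ s ⊆ natColumn k a, I i s → (s \ natColumn k c).Finite := by
  classical
  intro s hs hIs
  have h1 := hc (ofColumns fun l => if l = k then s else ∅) (by
      rw [subset_iff_natColumn]
      intro l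
      rw [natColumn_ofColumns]
      split_ifs with hl
      · exact hl ▸ hs
      · exact Set.empty_subset _) (by
      rw [succIdeals_succ]
      simp only [natColumn_ofColumns]
      refine ⟨(Set.finite_singleton k).subset fun l hl => ?_, fun l => ?_⟩
      · by_contra hlk
        simp [show l ≠ k from hlk] at hl
      · split_ifs
        · exact hIs
        · exact hempty i)
  have h2 := finite_natColumn h1 k
  rw [natColumn_diff, natColumn_ofColumns, if_pos rfl] at h2
  exact h2

theorem isSetGap_of_natColumn (hempty : ∀ i, I i ∅) {A : Finset (Fin (n + 1))} (h0 : 0 ∉ A)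
    {a : Set ℕ} {k : ℕ} (h : IsSetGap I (predIndices A) (natColumn k a)) :
    IsSetGap (succIdeals I) A a := by
  intro c hc
  obtain ⟨m, hm⟩ := h (fun i => natColumn k (c i.succ)) fun i hi =>
    finite_diff_natColumn hempty k (hc i.succ (by simpa using hi))
  refine ⟨Nat.pair k m, fun i => ?_⟩
  refine Fin.cases (fun hi => (h0 hi).elim) (fun i hi => ?_) i
  exact hm i (by simpa using hi)

/-- Each gap column has a point common to the old separators. One such point per column forms an
infinite set with finite columns, so the separator of the index `0`, if present, contains all but
finitely many of these points. -/
theorem isSetGap_of_infinite (hempty : ∀ i, I i ∅) {A : Finset (Fin (n + 1))}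
    (hA : (predIndices A).Nonempty) {a : Set ℕ}
    (h : {k | IsSetGap I (predIndices A) (natColumn k a)}.Infinite) :
    IsSetGap (succIdeals I) A a := by
  intro c hc
  have h1 : ∀ k ∈ {k | IsSetGap I (predIndices A) (natColumn k a)},
      ∃ m ∈ natColumn k a, ∀ i ∈ predIndices A, m ∈ natColumn k (c i.succ) := fun k hk =>
    IsSetGap.exists_mem hk hA fun i hi =>
      finite_diff_natColumn hempty k (hc i.succ (by simpa using hi))
  choose! m hma hm using h1
  by_cases h0 : 0 ∈ A
  · set T := {k | IsSetGap I (predIndices A) (natColumn k a)} with hT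
    let s : Set ℕ := (fun k => Nat.pair k (m k)) '' T
    have hinj : Set.InjOn (fun k => Nat.pair k (m k)) T :=
      fun k _ l _ hkl => (Nat.pair_eq_pair.1 hkl).1
    have hs : (s \ c 0).Finite := by
      refine hc 0 h0 s ?_ (succIdeals_zero.2 fun k => (Set.finite_singleton (m k)).subset ?_)
      · rintro _ ⟨k, hk, rfl⟩
        exact hma k hk
      · rintro q ⟨l, -, hl⟩
        obtain ⟨rfl, rfl⟩ := Nat.pair_eq_pair.1 hl
        rfl
    have hne : (s \ (s \ c 0)).Nonempty := ((h.image hinj).sdiff hs).nonempty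
    obtain ⟨_, ⟨k, hk, rfl⟩, hk0⟩ := hne
    refine ⟨Nat.pair k (m k), fun i => Fin.cases (fun _ => ?_) (fun i hi => ?_) i⟩
    · exact by_contra fun h' => hk0 ⟨⟨k, hk, rfl⟩, h'⟩
    · exact hm k hk i (by simpa using hi)
  · obtain ⟨k, hk⟩ := h.nonempty
    refine ⟨Nat.pair k (m k), fun i => Fin.cases (fun h => (h0 h).elim) (fun i hi => ?_) i⟩
    exact hm k hk i (by simpa using hi)

/-- Three cases. For `B = {0}`, take an infinite subset of `a` with finite columns. If `B` contains
`0` and an old index, apply the old condition in each of the infinitely many gap columns; ideals of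
old indices see only finitely many columns. If `0 ∉ B`, apply it in a single column, where sets with
finite columns are finite. -/
theorem IsSetJigsaw.succIdeals_jigsaw (hI : IsSetJigsaw I) {A B : Finset (Fin (n + 1))}
    (hB : B.Nonempty) (hBA : B ⊆ A) {a : Set ℕ} (ha : IsSetGap (succIdeals I) A a) :
    ∃ b ⊆ a, IsSetGap (succIdeals I) B b ∧
      ∀ i ∈ A \ B, ∀ s ⊆ b, succIdeals I i s → s.Finite := by
  classical
  have hempty : ∀ i, I i ∅ := fun i => hI.finite i ∅ Set.finite_empty
  have hBA' : predIndices B ⊆ predIndices A := fun i hi => by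
    simp only [mem_predIndices] at hi ⊢
    exact hBA hi
  rcases (predIndices B).eq_empty_or_nonempty with hB' | hB'
  · have hB0 : ∀ i ∈ B, i = 0 := by
      refine Fin.cases (fun _ => rfl) fun i hi => ?_
      simp [← mem_predIndices, hB'] at hi
    have h0 : (0 : Fin (n + 1)) ∈ B := by
      obtain ⟨i, hi⟩ := hB
      exact hB0 i hi ▸ hi
    obtain ⟨b, hba, hb, hIb⟩ := ha.exists_infinite (hBA h0)
    refine ⟨b, hba, fun c hc => ?_, fun i => Fin.cases (fun h => ?_) (fun i hi s hs hIs => ?_) i⟩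
    · obtain ⟨p, hpb, hp⟩ := (hb.sdiff (hc 0 h0 b subset_rfl hIb)).nonempty
      exact ⟨p, fun i hi => by_contra fun h' => hp ⟨hpb, hB0 i hi ▸ h'⟩⟩
    · simp [h0] at h
    · exact finite_of_natColumn hIs.1 fun k => (hIb k).subset (natColumn_mono k hs)
  by_cases h0 : (0 : Fin (n + 1)) ∈ B
  · have hinf := infinite_isSetGap_natColumn (hBA h0) ha
    have hex : ∀ k, ∃ b ⊆ natColumn k a,
        (IsSetGap I (predIndices A) (natColumn k a) → IsSetGap I (predIndices B) b) ∧
          ∀ i ∈ predIndices A \ predIndices B, ∀ s ⊆ b, I i s → s.Finite := by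
      intro k
      by_cases hk : IsSetGap I (predIndices A) (natColumn k a)
      · obtain ⟨b, hb, hb', hb''⟩ := hI.jigsaw _ _ hB' hBA' _ hk
        exact ⟨b, hb, fun _ => hb', hb''⟩
      · exact ⟨∅, Set.empty_subset _, fun h => (hk h).elim,
          fun i _ s hs _ => Set.finite_empty.subset hs⟩
    choose b hba hb hbA using hex
    refine ⟨ofColumns b, ?_, isSetGap_of_infinite hempty hB' (hinf.mono fun k hk => ?_),
      fun i => Fin.cases (fun h => ?_) (fun i hi s hs hIs => ?_) i⟩
    · rw [subset_iff_natColumn]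
      simpa using hba
    · change IsSetGap I _ _
      rw [natColumn_ofColumns]
      exact hb k hk
    · simp [h0] at h
    · refine finite_of_natColumn hIs.1 fun k => hbA k i (by simpa using hi) _ ?_ (hIs.2 k)
      simpa using natColumn_mono k hs
  · obtain ⟨k, -, hk⟩ := exists_isSetGap_natColumn ha Set.finite_empty fun _ => rfl
    obtain ⟨b, hba, hb, hbA⟩ := hI.jigsaw _ _ hB' hBA' _ hk
    refine ⟨ofColumns fun l => if l = k then b else ∅, ?_,
      isSetGap_of_natColumn hempty h0 (k := k) (by simpa using hb),
      fun i => Fin.cases (fun _ s hs hIs => ?_) (fun i hi s hs hIs => ?_) i⟩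
    · rw [subset_iff_natColumn]
      intro l
      rw [natColumn_ofColumns]
      split_ifs with hl
      · exact hl ▸ hba
      · exact Set.empty_subset _
    · refine finite_of_natColumn ((Set.finite_singleton k).subset fun l hl => ?_) hIs
      by_contra hlk
      have h1 := hl.mono (natColumn_mono l hs)
      simp [show l ≠ k from hlk] at h1
    · refine finite_of_natColumn hIs.1 fun l => ?_
      have h1 := natColumn_mono l hs
      rw [natColumn_ofColumns] at h1
      split_ifs at h1
      · exact hbA i (by simpa using hi) _ h1 (hIs.2 l)
      · exact Set.finite_empty.subset h1

theorem IsSetJigsaw.succIdeals (hn : 1 ≤ n) (hI : IsSetJigsaw I) : IsSetJigsaw (succIdeals I) where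
  subset i := by
    refine Fin.cases (fun s t ht hst k => (ht k).subset (natColumn_mono k hst)) (fun i s t ht hst => ?_) i
    exact ⟨ht.1.subset fun k hk => hk.mono (natColumn_mono k hst),
      fun k => hI.subset i _ _ (ht.2 k) (natColumn_mono k hst)⟩
  union i := by
    refine Fin.cases (fun s t hs ht k => (hs k).union (ht k)) (fun i s t hs ht => ?_) i
    refine ⟨(hs.1.union ht.1).subset ?_, fun k => hI.union i _ _ (hs.2 k) (ht.2 k)⟩
    rintro k ⟨m, hm | hm⟩
    · exact Or.inl ⟨m, hm⟩
    · exact Or.inr ⟨m, hm⟩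
  finite i := by
    refine Fin.cases (fun s hs k => finite_natColumn hs k) (fun i s hs => ?_) i
    exact ⟨finite_nonempty_natColumn hs, fun k => hI.finite i _ (finite_natColumn hs k)⟩
  orthogonal i j := by
    have h : ∀ (i : Fin n) (s t : Set ℕ), _root_.succIdeals I 0 s → _root_.succIdeals I i.succ t →
        (s ∩ t).Finite := fun i s t hs ht =>
      finite_of_natColumn (ht.1.subset fun k hk => hk.mono (natColumn_mono k Set.inter_subset_right))
        fun k => (hs k).subset (natColumn_mono k Set.inter_subset_left)
    refine Fin.cases (Fin.cases (fun h => (h rfl).elim) (fun j _ s t hs ht => h j s t hs ht) j)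
      (fun i => Fin.cases (fun _ s t hs ht => Set.inter_comm t s ▸ h i t s ht hs)
        (fun j hij s t hs ht => ?_) j) i
    refine finite_of_natColumn (hs.1.subset fun k hk => hk.mono
      (natColumn_mono k Set.inter_subset_left)) fun k => ?_
    exact hI.orthogonal i j (fun h => hij (h ▸ rfl)) _ _ (hs.2 k) (ht.2 k)
  dense s hs := by
    classical
    -- Either `s` itself lies in the new ideal, or density of the old jigsaw applies inside an
    -- infinite column.
    by_cases h : ∀ k, (natColumn k s).Finite
    · exact ⟨0, s, subset_rfl, hs, h⟩
    · push Not at h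
      obtain ⟨k, hk⟩ := h
      obtain ⟨i, t, hts, ht, hIt⟩ := hI.dense _ hk
      refine ⟨i.succ, Nat.pair k '' t, ?_, ht.image fun _ _ _ _ h => (Nat.pair_eq_pair.1 h).2, ?_⟩
      · rintro _ ⟨m, hm, rfl⟩
        exact hts hm
      · rw [succIdeals_succ]
        refine ⟨(Set.finite_singleton k).subset ?_, fun l => hI.subset i _ _ hIt ?_⟩
        · rintro l ⟨m, q, -, hq⟩
          exact (Nat.pair_eq_pair.1 hq).1.symm
        · rintro m ⟨q, hq, hqm⟩
          exact (Nat.pair_eq_pair.1 hqm).2 ▸ hq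
  gap := by
    have h1 : predIndices (Finset.univ : Finset (Fin (n + 1))) = Finset.univ := by
      ext i
      simp
    refine isSetGap_of_infinite (fun i => hI.finite i ∅ Set.finite_empty) ?_ ?_
    · rw [h1]
      exact ⟨⟨0, hn⟩, Finset.mem_univ _⟩
    · rw [h1]
      convert Set.infinite_univ (α := ℕ)
      exact Set.eq_univ_of_forall fun k => hI.gap
  jigsaw A B hB hBA a ha := hI.succIdeals_jigsaw hB hBA ha

theorem isSetJigsaw_one : IsSetJigsaw (n := 1) fun _ _ => True where
  subset _ _ _ _ _ := trivial
  union _ _ _ _ _ := trivial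
  finite _ _ _ := trivial
  orthogonal i j h := (h (Subsingleton.elim i j)).elim
  dense s hs := ⟨0, s, subset_rfl, hs, trivial⟩
  gap c hc := by
    obtain ⟨p, -, hp⟩ := (Set.infinite_univ.sdiff
      (hc 0 (Finset.mem_univ _) Set.univ subset_rfl trivial)).nonempty
    refine ⟨p, fun i _ => ?_⟩
    rw [Subsingleton.elim i 0]
    exact by_contra fun h => hp ⟨trivial, h⟩
  jigsaw A B hB hBA a ha := by
    obtain ⟨i, hi⟩ := hB
    have h : B = A := hBA.antisymm fun j _ => Subsingleton.elim i j ▸ hi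
    subst h
    exact ⟨a, subset_rfl, ha, by simp⟩

theorem exists_isSetJigsaw (hn : 1 ≤ n) : ∃ I : Fin n → Set ℕ → Prop, IsSetJigsaw I := by
  induction n, hn using Nat.le_induction with
  | base => exact ⟨_, isSetJigsaw_one⟩
  | succ n hn ih =>
    obtain ⟨I, hI⟩ := ih
    exact ⟨_, hI.succIdeals hn⟩

end SetJigsaw

/-! ### From ideals of sets to ideals of `𝓟(ω)/fin`. -/

namespace PowerSetModFin

theorem mk_eq_bot {s : Set ℕ} : mk s = ⊥ ↔ s.Finite := by
  rw [← le_bot_iff]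
  change mk s ≤ mk ∅ ↔ _
  rw [mk_le_mk, Set.sdiff_empty]

theorem mk_finset_inf {ι : Type*} (t : Finset ι) (c : ι → Set ℕ) :
    t.inf (fun i => mk (c i)) = mk {p | ∀ i ∈ t, p ∈ c i} := by
  classical
  induction t using Finset.induction_on with
  | empty =>
    simp only [Finset.inf_empty, Finset.notMem_empty, false_imp_iff, implies_true]
    rfl
  | insert i t hi ih =>
    rw [Finset.inf_insert, ih, ← mk_inter]
    congr 1
    ext p
    simp

section Ideals

variable {n : ℕ} {I : Fin n → Set ℕ → Prop}

/-- The ideals of `𝓟(ω)/fin` induced by a jigsaw of ideals of sets. -/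
def setJigsawIdeal (hI : IsSetJigsaw I) (i : Fin n) : Order.Ideal PowerSetModFin :=
  Order.IsIdeal.toIdeal (I := mk '' {s | I i s})
    { IsLowerSet := by
        rintro _ b hb ⟨s, hs, rfl⟩
        obtain ⟨t, rfl⟩ := mk_surjective b
        refine ⟨t, ?_, rfl⟩
        refine hI.subset i _ _ (hI.union i _ _ hs (hI.finite i _ (mk_le_mk.1 hb))) fun p hp => ?_
        by_cases h : p ∈ s
        · exact Or.inl h
        · exact Or.inr ⟨hp, h⟩
      Nonempty := ⟨_, ∅, hI.finite i _ Set.finite_empty, rfl⟩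
      Directed := by
        rintro _ ⟨s, hs, rfl⟩ _ ⟨t, ht, rfl⟩
        refine ⟨mk (s ∪ t), ⟨_, hI.union i _ _ hs ht, rfl⟩, ?_, ?_⟩
        · rw [mk_union]
          exact le_sup_left
        · rw [mk_union]
          exact le_sup_right }

/-- Membership does not depend on the representative because the ideals contain the finite sets. -/
theorem mk_mem_setJigsawIdeal (hI : IsSetJigsaw I) {i : Fin n} {s : Set ℕ} :
    mk s ∈ setJigsawIdeal hI i ↔ I i s := by
  refine ⟨fun ⟨t, ht, h⟩ => ?_, fun h => ⟨s, h, rfl⟩⟩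
  refine hI.subset i _ _ (hI.union i _ _ ht (hI.finite i _ (mk_le_mk.1 h.ge))) fun p hp => ?_
  by_cases h : p ∈ t
  · exact Or.inl h
  · exact Or.inr ⟨hp, h⟩

theorem mk_mem_orthogonalSet (hI : IsSetJigsaw I) {i : Fin n} {s : Set ℕ} :
    mk s ∈ orthogonalSet (setJigsawIdeal hI i : Set PowerSetModFin) ↔
      ∀ t ⊆ s, I i t → t.Finite := by
  constructor
  · intro h t hts ht
    have h1 := h _ ((mk_mem_setJigsawIdeal hI).2 ht)
    rwa [← mk_inter, mk_eq_bot, Set.inter_eq_left.2 hts] at h1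
  · rintro h _ ⟨t, ht, rfl⟩
    rw [← mk_inter, mk_eq_bot]
    exact h _ Set.inter_subset_right (hI.subset i _ _ ht Set.inter_subset_left)

theorem setJigsawIdeal_orthogonal (hI : IsSetJigsaw I) (i j : Fin n) (hij : i ≠ j) :
    ∀ a ∈ setJigsawIdeal hI i, ∀ b ∈ setJigsawIdeal hI j, a ⊓ b = ⊥ := by
  rintro _ ⟨s, hs, rfl⟩ _ ⟨t, ht, rfl⟩
  rw [← mk_inter, mk_eq_bot]
  exact hI.orthogonal i j hij s t hs ht

theorem not_separated_iff_isSetGap (hI : IsSetJigsaw I) {A : Finset (Fin n)} (hA : A.Nonempty)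
    (a : Set ℕ) :
    (∀ c : Fin n → PowerSetModFin,
      (∀ i ∈ A, ∀ b ∈ restrictIdeal (setJigsawIdeal hI i) (mk a), b ≤ c i) → A.inf c ≠ ⊥) ↔
      IsSetGap I A a := by
  constructor
  · intro h c hc
    have h1 := h (fun i => mk (c i)) fun i hi b hb => by
      rw [mem_restrictIdeal] at hb
      obtain ⟨⟨s, hs, rfl⟩, hsa⟩ := hb
      have h2 := hc i hi (s ∩ a) Set.inter_subset_right
        (hI.subset i _ _ hs Set.inter_subset_left)
      rw [mk_le_mk] at hsa ⊢
      refine (hsa.union h2).subset fun p hp => ?_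
      by_cases hpa : p ∈ a
      · exact Or.inr ⟨⟨hp.1, hpa⟩, hp.2⟩
      · exact Or.inl ⟨hp.1, hpa⟩
    rw [mk_finset_inf, Ne, mk_eq_bot] at h1
    exact Set.Infinite.nonempty h1
  · intro h c hc
    choose d hd using fun i => mk_surjective (c i)
    obtain rfl : (fun i => mk (d i)) = c := funext hd
    rw [mk_finset_inf, Ne, mk_eq_bot]
    refine h.infinite hA fun i hi s hsa hs => ?_
    refine mk_le_mk.1 (hc i hi _ (mem_restrictIdeal.2 ⟨⟨s, hs, rfl⟩, mk_le_mk.2 ?_⟩))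
    rw [Set.sdiff_eq_empty.2 hsa]
    exact Set.finite_empty

theorem isMultipleGap_iff_isSetGap (hI : IsSetJigsaw I) {A : Finset (Fin n)} (hA : A.Nonempty)
    (a : Set ℕ) :
    IsMultipleGap (fun i : A => restrictIdeal (setJigsawIdeal hI i) (mk a)) ↔ IsSetGap I A a := by
  classical
  rw [← not_separated_iff_isSetGap hI hA]
  constructor
  · intro h c hc
    have h1 := h.not_separated (fun i => c i) fun i => hc i i.2
    rwa [Finset.univ_eq_attach, Finset.inf_attach A c] at h1
  · refine fun h => ⟨fun i j hij x hx y hy => setJigsawIdeal_orthogonal hI i j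
      (Subtype.coe_injective.ne hij) x (mem_restrictIdeal.1 hx).1 y (mem_restrictIdeal.1 hy).1,
      fun c hc => ?_⟩
    have h1 := h (fun i => if hi : i ∈ A then c ⟨i, hi⟩ else ⊥) fun i hi => by
      rw [dif_pos hi]
      exact hc ⟨i, hi⟩
    rw [← Finset.inf_attach, ← Finset.univ_eq_attach] at h1
    simpa using h1

theorem isDenseJigsaw_setJigsawIdeal (hn : 1 ≤ n) (hI : IsSetJigsaw I) :
    IsDenseJigsaw (setJigsawIdeal hI) where
  orthogonal := setJigsawIdeal_orthogonal hI
  not_separated c hc := by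
    refine (not_separated_iff_isSetGap hI ⟨⟨0, hn⟩, Finset.mem_univ _⟩ Set.univ).2 hI.gap c ?_
    exact fun i _ b hb => hc i b (mem_restrictIdeal.1 hb).1
  dense := by
    refine Set.Subset.antisymm (fun b hb => ?_) ?_
    · obtain ⟨s, rfl⟩ := mk_surjective b
      rw [Set.mem_singleton_iff, mk_eq_bot]
      by_contra hs
      obtain ⟨i, t, hts, ht, hIt⟩ := hI.dense s hs
      refine ht (mk_eq_bot.1 ?_)
      have h1 := hb (mk t) ⟨fun j => if j = i then mk t else ⊥, fun j => ?_, ?_⟩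
      · rwa [← mk_inter, Set.inter_eq_left.2 hts] at h1
      · dsimp only
        split_ifs with h
        · exact h ▸ (mk_mem_setJigsawIdeal hI).2 hIt
        · exact Order.Ideal.bot_mem _
      · refine le_antisymm ?_ (Finset.sup_le fun j _ => ?_)
        · exact (le_of_eq (if_pos rfl).symm).trans
            (Finset.le_sup (f := fun j => if j = i then mk t else ⊥) (Finset.mem_univ i))
        · split_ifs
          · exact le_rfl
          · exact bot_le
    · rintro _ rfl a -
      exact inf_bot_eq a
  jigsaw B hB _ A hBA a ha := by
    obtain ⟨a, rfl⟩ := mk_surjective a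
    rw [isMultipleGap_iff_isSetGap hI (hB.mono hBA)] at ha
    obtain ⟨b, hba, hb, hbA⟩ := hI.jigsaw A B hB hBA a ha
    refine ⟨mk b, mk_le_mk.2 ?_, (isMultipleGap_iff_isSetGap hI hB b).2 hb,
      fun i hi => (mk_mem_orthogonalSet hI).2 (hbA i hi)⟩
    rw [Set.sdiff_eq_empty.2 hba]
    exact Set.finite_empty

theorem hasDenseJigsaws : HasDenseJigsaws PowerSetModFin := fun _ hn =>
  let ⟨_, hI⟩ := exists_isSetJigsaw hn
  ⟨_, isDenseJigsaw_setJigsawIdeal hn hI⟩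

end Ideals

/-- For the lower bound, `s` is sent to the union of the full columns over `s`; each column is
infinite, so distinct `s` stay distinct modulo finite sets. -/
theorem mk_powerSetModFin : #PowerSetModFin = 𝔠 := by
  have h : #(Set ℕ) = 𝔠 := by simp
  refine le_antisymm (h ▸ Cardinal.mk_le_of_surjective mk_surjective) ?_
  rw [← h]
  refine Cardinal.mk_le_of_injective (f := fun s : Set ℕ => mk {p | p.unpair.1 ∈ s}) ?_
  have hle : ∀ s t : Set ℕ, mk {p | p.unpair.1 ∈ s} ≤ mk {p | p.unpair.1 ∈ t} → s ⊆ t := by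
    intro s t hst k hk
    rw [mk_le_mk] at hst
    by_contra hkt
    refine (Set.infinite_range_of_injective (f := Nat.pair k)
      fun _ _ h => (Nat.pair_eq_pair.1 h).2) (hst.subset ?_)
    rintro _ ⟨m, rfl⟩
    simp [hk, hkt]
  exact fun s t hst => (hle s t hst.le).antisymm (hle t s hst.ge)

end PowerSetModFin

/-! ### Indicators and the density character of `C(St(𝓑))`. -/

namespace StoneSpace

variable {𝓑 : Type u} [BooleanAlgebra 𝓑] (𝕜 : Type v) [RCLike 𝕜]

/-- The indicator of a basic clopen set, as a continuous function. -/
noncomputable def indicator (a : 𝓑) : C(StoneSpace 𝓑, 𝕜) :=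
  (LocallyConstant.charFn 𝕜 (isClopen_basicOpen a) : C(StoneSpace 𝓑, 𝕜))

variable {𝕜}

theorem indicator_apply_of_mem {a : 𝓑} {U : StoneSpace 𝓑} (h : a ∈ U.carrier) :
    indicator 𝕜 a U = 1 :=
  Set.indicator_of_mem (show U ∈ basicOpen a from h) _

theorem indicator_apply_of_notMem {a : 𝓑} {U : StoneSpace 𝓑} (h : a ∉ U.carrier) :
    indicator 𝕜 a U = 0 :=
  Set.indicator_of_notMem (show U ∉ basicOpen a from h) _

theorem indicator_mul_indicator (a b : 𝓑) :
    indicator 𝕜 a * indicator 𝕜 b = indicator 𝕜 (a ⊓ b) := by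
  ext U
  rw [ContinuousMap.mul_apply]
  by_cases ha : a ∈ U.carrier
  · by_cases hb : b ∈ U.carrier
    · rw [indicator_apply_of_mem ha, indicator_apply_of_mem hb,
        indicator_apply_of_mem (U.inf_mem ha hb), one_mul]
    · rw [indicator_apply_of_notMem hb, indicator_apply_of_notMem fun h => hb (inf_mem_iff.1 h).2,
        mul_zero]
  · rw [indicator_apply_of_notMem ha, indicator_apply_of_notMem fun h => ha (inf_mem_iff.1 h).1,
      zero_mul]

theorem star_indicator (a : 𝓑) : star (indicator 𝕜 a) = indicator 𝕜 a := by
  ext U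
  rw [ContinuousMap.star_apply]
  by_cases ha : a ∈ U.carrier
  · rw [indicator_apply_of_mem ha, star_one]
  · rw [indicator_apply_of_notMem ha, star_zero]

variable (𝓑 𝕜) in
/-- The algebra of the linear combinations of indicators. -/
noncomputable def simpleAlgebra : StarSubalgebra 𝕜 C(StoneSpace 𝓑, 𝕜) where
  __ := (Submodule.span 𝕜 (Set.range (indicator 𝕜 : 𝓑 → C(StoneSpace 𝓑, 𝕜)))).toSubalgebra
    (Submodule.subset_span ⟨⊤, by
      ext U
      exact indicator_apply_of_mem U.top_mem⟩)
    (fun f g hf hg => by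
      have h := Submodule.mul_mem_mul hf hg
      rw [Submodule.span_mul_span] at h
      refine Submodule.span_mono ?_ h
      rintro _ ⟨_, ⟨a, rfl⟩, _, ⟨b, rfl⟩, rfl⟩
      exact ⟨a ⊓ b, (indicator_mul_indicator a b).symm⟩)
  star_mem' {f} hf := by
    change f ∈ Submodule.span 𝕜 _ at hf
    change star f ∈ Submodule.span 𝕜 _
    induction hf using Submodule.span_induction with
    | mem f hf =>
      obtain ⟨a, rfl⟩ := hf
      rw [star_indicator]
      exact Submodule.subset_span ⟨a, rfl⟩
    | zero => simp
    | add f g _ _ hf hg =>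
      rw [star_add]
      exact add_mem hf hg
    | smul c f _ hf =>
      rw [star_smul]
      exact Submodule.smul_mem _ _ hf

variable (𝓑 𝕜) in
theorem dense_span_indicator :
    -- Stone–Weierstrass: the span is a star subalgebra, and indicators separate ultrafilters.
    Dense (Submodule.span 𝕜 (Set.range (indicator 𝕜 : 𝓑 → C(StoneSpace 𝓑, 𝕜))) :
      Set C(StoneSpace 𝓑, 𝕜)) := by
  have h := ContinuousMap.starSubalgebra_topologicalClosure_eq_top_of_separatesPoints
    (simpleAlgebra 𝓑 𝕜) (by
      intro U V hUV
      obtain ⟨a, ha, hb⟩ := exists_mem_notMem hUV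
      refine ⟨indicator 𝕜 a, ⟨_, Submodule.subset_span ⟨a, rfl⟩, rfl⟩, ?_⟩
      rw [indicator_apply_of_mem ha, indicator_apply_of_notMem hb]
      exact one_ne_zero)
  intro f
  have h1 : f ∈ (simpleAlgebra 𝓑 𝕜).topologicalClosure := h ▸ StarSubalgebra.mem_top
  exact h1

theorem one_le_dist_indicator {a b : 𝓑} (h : a ≠ b) :
    1 ≤ dist (indicator 𝕜 a) (indicator 𝕜 b) := by
  obtain ⟨U, hU⟩ : ∃ U : StoneSpace 𝓑, ¬ (a ∈ U.carrier ↔ b ∈ U.carrier) := by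
    by_contra! hne
    exact h (basicOpen_injective (Set.ext hne))
  refine le_trans ?_ (ContinuousMap.dist_apply_le_dist U)
  by_cases ha : a ∈ U.carrier
  · rw [indicator_apply_of_mem ha, indicator_apply_of_notMem fun hb => hU ⟨fun _ => hb, fun _ => ha⟩]
    simp
  · rw [indicator_apply_of_notMem ha, indicator_apply_of_mem (by tauto)]
    simp

variable (𝓑 𝕜) in
-- The upper bound comes from the dense span of the indicators. For the lower bound, indicators are
-- at mutual distance at least 1, so points of a dense set chosen within 1/2 of them are distinct.
theorem densityCharacter_continuousMap [Infinite 𝓑] :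
    densityCharacter C(StoneSpace 𝓑, 𝕜) = Cardinal.lift.{v} #𝓑 := by
  apply le_antisymm
  · obtain ⟨D, hD, hspan⟩ := exists_card_le_span_subset_closure 𝕜
      (Set.range (indicator 𝕜 : 𝓑 → C(StoneSpace 𝓑, 𝕜)))
    have hdense : Dense D := fun f =>
      closure_minimal hspan isClosed_closure (dense_span_indicator 𝓑 𝕜 f)
    refine (densityCharacter_le_of_dense hdense).trans (hD.trans (max_le ?_ ?_))
    · rw [Cardinal.aleph0_le_lift]
      exact Cardinal.aleph0_le_mk 𝓑
    · have h := Cardinal.mk_range_le_lift (f := (indicator 𝕜 : 𝓑 → C(StoneSpace 𝓑, 𝕜)))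
      rwa [Cardinal.lift_umax.{u, v}, Cardinal.lift_id'.{u, max u v}] at h
  · obtain ⟨D, hD, hcard⟩ := exists_dense_card_eq_densityCharacter C(StoneSpace 𝓑, 𝕜)
    rw [← hcard]
    choose d hdD hd using fun a : 𝓑 => Metric.mem_closure_iff.1 (hD (indicator 𝕜 a)) (1 / 2) (by norm_num)
    have hinj : Function.Injective fun a : 𝓑 => (⟨d a, hdD a⟩ : D) := by
      intro a b hab
      have hab' : d a = d b := congrArg Subtype.val hab
      by_contra hne
      have h1 := one_le_dist_indicator (𝕜 := 𝕜) hne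
      have h2 := dist_triangle_right (indicator 𝕜 a) (indicator 𝕜 b) (d a)
      have h3 := hd b
      rw [← hab'] at h3
      linarith [hd a]
    have h := Cardinal.mk_le_of_injective (f := fun a : ULift.{v} 𝓑 => (⟨d a.down, hdD a.down⟩ : D))
      fun a b hab => ULift.ext _ _ (hinj hab)
    rwa [Cardinal.mk_uLift] at h

end StoneSpace

/-! ### The isometry of `ℓ_∞/c₀` with `C(St(𝓟(ω)/fin))`. -/

section LInftyModCZero

open PowerSetModFin

/-- The ultrafilter on `ℕ` that corresponds to a point of the Stone space of `𝓟(ω)/fin`. -/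
def StoneSpace.toUltrafilter (U : StoneSpace PowerSetModFin) : Ultrafilter ℕ :=
  Ultrafilter.ofComplNotMemIff
    { sets := {s | PowerSetModFin.mk s ∈ U.carrier}
      univ_sets := U.top_mem
      sets_of_superset := fun {s t} hs hst => U.mem_of_le hs (mk_le_mk.2 (by
        rw [Set.sdiff_eq_empty.2 hst]
        exact Set.finite_empty))
      inter_sets := fun {s t} hs ht => U.inf_mem hs ht }
    fun s => by
      change PowerSetModFin.mk sᶜ ∉ U.carrier ↔ PowerSetModFin.mk s ∈ U.carrier
      rw [mk_compl, StoneSpace.compl_mem_iff, not_not]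

theorem StoneSpace.mem_toUltrafilter {U : StoneSpace PowerSetModFin} {s : Set ℕ} :
    s ∈ (U.toUltrafilter : Filter ℕ) ↔ PowerSetModFin.mk s ∈ U.carrier := Iff.rfl

variable {𝕜 : Type v} [RCLike 𝕜]

namespace LInfty

theorem exists_tendsto (x : LInfty 𝕜) (G : Ultrafilter ℕ) : ∃ z, Tendsto (x : ℕ → 𝕜) G (𝓝 z) := by
  obtain ⟨z, -, hz⟩ := (isCompact_closedBall (0 : 𝕜) ‖x‖).ultrafilter_le_nhds (G.map x) (by
    rw [Ultrafilter.coe_map, le_principal_iff, mem_map]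
    filter_upwards with k
    simpa using lp.norm_apply_le_norm ENNReal.top_ne_zero x k)
  exact ⟨z, hz⟩

/-- The limit of a bounded sequence along the ultrafilter of a point of the Stone space. -/
noncomputable def stoneLimit (x : LInfty 𝕜) (U : StoneSpace PowerSetModFin) : 𝕜 :=
  (exists_tendsto x U.toUltrafilter).choose

theorem tendsto_stoneLimit (x : LInfty 𝕜) (U : StoneSpace PowerSetModFin) :
    Tendsto (x : ℕ → 𝕜) U.toUltrafilter (𝓝 (stoneLimit x U)) :=
  (exists_tendsto x U.toUltrafilter).choose_spec

theorem stoneLimit_eq {x : LInfty 𝕜} {U : StoneSpace PowerSetModFin} {z : 𝕜}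
    (h : Tendsto (x : ℕ → 𝕜) U.toUltrafilter (𝓝 z)) : stoneLimit x U = z :=
  tendsto_nhds_unique (tendsto_stoneLimit x U) h

theorem continuous_stoneLimit (x : LInfty 𝕜) : Continuous (stoneLimit x) := by
  rw [continuous_iff_continuousAt]
  intro U
  rw [ContinuousAt, Metric.tendsto_nhds]
  intro ε hε
  have h1 := Metric.tendsto_nhds.1 (tendsto_stoneLimit x U) (ε / 2) (half_pos hε)
  have h2 := (StoneSpace.isClopen_basicOpen _).isOpen.mem_nhds (StoneSpace.mem_toUltrafilter.1 h1)
  filter_upwards [h2] with V hV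
  refine lt_of_le_of_lt ?_ (half_lt_self hε)
  refine le_of_tendsto ((tendsto_stoneLimit x V).dist tendsto_const_nhds) ?_
  have h3 : ∀ᶠ k in (V.toUltrafilter : Filter ℕ), dist (x k) (stoneLimit x U) < ε / 2 := hV
  exact h3.mono fun k hk => hk.le

variable (𝕜) in
/-- The limits along ultrafilters, as a map into the continuous functions on the Stone space. -/
noncomputable def toContinuousMap : LInfty 𝕜 →ₗ[𝕜] C(StoneSpace PowerSetModFin, 𝕜) where
  toFun x := ⟨stoneLimit x, continuous_stoneLimit x⟩
  map_add' x y := by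
    ext U
    exact stoneLimit_eq ((tendsto_stoneLimit x U).add (tendsto_stoneLimit y U))
  map_smul' c x := by
    ext U
    exact stoneLimit_eq ((tendsto_stoneLimit x U).const_smul c)

theorem toContinuousMap_apply (x : LInfty 𝕜) (U : StoneSpace PowerSetModFin) :
    toContinuousMap 𝕜 x U = stoneLimit x U := rfl

theorem norm_toContinuousMap_le (x : LInfty 𝕜) : ‖toContinuousMap 𝕜 x‖ ≤ ‖x‖ := by
  refine (ContinuousMap.norm_le _ (norm_nonneg _)).2 fun U => ?_
  exact le_of_tendsto (tendsto_stoneLimit x U).norm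
    (Eventually.of_forall fun k => lp.norm_apply_le_norm ENNReal.top_ne_zero x k)

theorem toContinuousMap_eq_zero {x : LInfty 𝕜} (hx : x ∈ cZero 𝕜) : toContinuousMap 𝕜 x = 0 := by
  ext U
  have h1 : Tendsto (x : ℕ → 𝕜) atTop (𝓝 0) := hx
  rw [← Nat.cofinite_eq_atTop] at h1
  refine stoneLimit_eq (h1.mono_left fun s hs => ?_)
  rw [StoneSpace.mem_toUltrafilter]
  refine U.mem_of_le U.top_mem (mk_le_mk.2 ?_)
  rw [← Set.compl_eq_univ_sdiff]
  exact hs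

/-- For `r` above the norm of the limit function, `‖x k‖ ≥ r` for only finitely many `k`, since an
infinite set of such `k` would belong to an ultrafilter of the Stone space. Setting these
coordinates to zero does not change the class of `x`. -/
theorem norm_mk_le_norm_toContinuousMap (x : LInfty 𝕜) :
    ‖(Submodule.Quotient.mk x : LInftyModCZero 𝕜)‖ ≤ ‖toContinuousMap 𝕜 x‖ := by
  classical
  refine le_of_forall_gt_imp_ge_of_dense fun r hr => ?_
  have hr0 : 0 ≤ r := (norm_nonneg _).trans hr.le
  set s : Set ℕ := {k | r ≤ ‖x k‖} with hs
  have hfin : s.Finite := by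
    by_contra hinf
    obtain ⟨U, hU⟩ := StoneSpace.exists_mem (a := mk s) (by rwa [Ne, mk_eq_bot])
    have h1 : r ≤ ‖toContinuousMap 𝕜 x U‖ :=
      ge_of_tendsto (tendsto_stoneLimit x U).norm (StoneSpace.mem_toUltrafilter.2 hU)
    exact absurd (h1.trans (ContinuousMap.norm_coe_le_norm _ U)) hr.not_ge
  have hbound : ∀ k, ‖sᶜ.indicator (x : ℕ → 𝕜) k‖ ≤ r := by
    intro k
    by_cases hk : k ∈ s
    · rw [Set.indicator_of_notMem (by simpa using hk), norm_zero]
      exact hr0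
    · rw [Set.indicator_of_mem hk]
      exact (not_le.1 hk).le
  let y : LInfty 𝕜 := ⟨sᶜ.indicator x, memℓp_infty ⟨r, by
    rintro _ ⟨k, rfl⟩
    exact hbound k⟩⟩
  have hxy : (Submodule.Quotient.mk x : LInftyModCZero 𝕜) = Submodule.Quotient.mk y := by
    rw [Submodule.Quotient.eq]
    change Tendsto (fun k => (x - y) k) atTop (𝓝 0)
    rw [← Nat.cofinite_eq_atTop]
    refine tendsto_const_nhds.congr' ?_
    filter_upwards [hfin.compl_mem_cofinite] with k hk
    have h1 : y k = x k := Set.indicator_of_mem hk _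
    rw [lp.coeFn_sub, Pi.sub_apply, h1, sub_self]
  rw [hxy]
  exact (Submodule.Quotient.norm_mk_le _ y).trans (lp.norm_le_of_forall_le hr0 hbound)

theorem toContinuousMap_indicator (s : Set ℕ) :
    ∃ x : LInfty 𝕜, toContinuousMap 𝕜 x = StoneSpace.indicator 𝕜 (mk s) := by
  refine ⟨⟨s.indicator fun _ => 1, memℓp_infty ⟨1, ?_⟩⟩, ?_⟩
  · rintro _ ⟨k, rfl⟩
    exact (norm_indicator_le_norm_self _ _).trans (by simp)
  · ext U
    rw [toContinuousMap_apply]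
    by_cases h : mk s ∈ U.carrier
    · rw [StoneSpace.indicator_apply_of_mem h]
      refine stoneLimit_eq (tendsto_const_nhds.congr' ?_)
      filter_upwards [StoneSpace.mem_toUltrafilter.2 h] with k hk
      exact (Set.indicator_of_mem hk fun _ => (1 : 𝕜)).symm
    · rw [StoneSpace.indicator_apply_of_notMem h]
      refine stoneLimit_eq (tendsto_const_nhds.congr' ?_)
      have h' : sᶜ ∈ (U.toUltrafilter : Filter ℕ) := by
        rwa [StoneSpace.mem_toUltrafilter, mk_compl, StoneSpace.compl_mem_iff]
      filter_upwards [h'] with k hk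
      exact (Set.indicator_of_notMem hk fun _ => (1 : 𝕜)).symm

end LInfty

variable (𝕜) in
/-- The isometric embedding of `ℓ_∞/c₀` into the continuous functions on the Stone space. -/
noncomputable def LInftyModCZero.toContinuousMap :
    LInftyModCZero 𝕜 →ₗᵢ[𝕜] C(StoneSpace PowerSetModFin, 𝕜) where
  __ := (cZero 𝕜).liftQ (LInfty.toContinuousMap 𝕜) fun _ hx => LInfty.toContinuousMap_eq_zero hx
  norm_map' q := by
    obtain ⟨x, rfl⟩ := Submodule.Quotient.mk_surjective _ q
    change ‖LInfty.toContinuousMap 𝕜 x‖ = _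
    refine le_antisymm (le_of_forall_pos_le_add fun ε hε => ?_)
      (LInfty.norm_mk_le_norm_toContinuousMap x)
    obtain ⟨y, hy, hyε⟩ := Submodule.Quotient.norm_mk_lt (Submodule.Quotient.mk x : LInftyModCZero 𝕜) hε
    have h1 := LInfty.toContinuousMap_eq_zero ((Submodule.Quotient.eq _).1 hy)
    rw [map_sub, sub_eq_zero] at h1
    rw [← h1]
    exact (LInfty.norm_toContinuousMap_le y).trans hyε.le

/-- The range is closed, being an isometric image of a complete space, and contains the indicators,
whose span is dense. -/
theorem LInftyModCZero.toContinuousMap_surjective :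
    Function.Surjective (LInftyModCZero.toContinuousMap 𝕜) := by
  have hclosed : IsClosed (Set.range (LInftyModCZero.toContinuousMap 𝕜)) :=
    (LInftyModCZero.toContinuousMap 𝕜).isometry.isClosedEmbedding.isClosed_range
  intro f
  have h1 : Submodule.span 𝕜 (Set.range (StoneSpace.indicator 𝕜)) ≤
      LinearMap.range (LInftyModCZero.toContinuousMap 𝕜).toLinearMap := by
    rw [Submodule.span_le]
    rintro _ ⟨a, rfl⟩
    obtain ⟨s, rfl⟩ := mk_surjective a
    obtain ⟨x, hx⟩ := LInfty.toContinuousMap_indicator (𝕜 := 𝕜) s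
    exact ⟨Submodule.Quotient.mk x, hx⟩
  exact closure_minimal h1 hclosed (StoneSpace.dense_span_indicator PowerSetModFin 𝕜 f)

end LInftyModCZero

/-! ### Transfer along isometries and conclusion. -/

theorem UncomplementedInSuperspace.of_linearIsometryEquiv {𝕜 : Type v} [RCLike 𝕜] {E E' : Type w}
    [NormedAddCommGroup E] [NormedSpace 𝕜 E] [NormedAddCommGroup E'] [NormedSpace 𝕜 E']
    (e : E' ≃ₗᵢ[𝕜] E) {κ : Cardinal.{w}} (h : UncomplementedInSuperspace 𝕜 E κ) :
    UncomplementedInSuperspace 𝕜 E' κ := by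
  obtain ⟨X, _, _, _, J, hX, hJ⟩ := h
  refine ⟨X, inferInstance, inferInstance, inferInstance, J.comp e.toLinearIsometry, hX, ?_⟩
  have h1 : LinearMap.range (J.comp e.toLinearIsometry).toLinearMap = LinearMap.range J.toLinearMap :=
    SetLike.coe_injective (e.surjective.range_comp J)
  rwa [h1]

theorem UncomplementedInSuperspace.not_isInjectiveBanachSpace {𝕜 : Type v} [RCLike 𝕜] {E : Type w}
    [NormedAddCommGroup E] [NormedSpace 𝕜 E] {κ : Cardinal.{w}}
    (h : UncomplementedInSuperspace 𝕜 E κ) : ¬ IsInjectiveBanachSpace 𝕜 E := by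
  obtain ⟨X, _, _, _, J, -, hJ⟩ := h
  exact fun hE => hJ (hE X J)

theorem HasDenseJigsaws.uncomplementedInSuperspace (𝕜 : Type v) [RCLike 𝕜] {𝓑 : Type u}
    [BooleanAlgebra 𝓑] (h : HasDenseJigsaws 𝓑) :
    UncomplementedInSuperspace 𝕜 C(StoneSpace 𝓑, 𝕜) (densityCharacter C(StoneSpace 𝓑, 𝕜)) :=
  uncomplementedInSuperspace_of_isDenseClosedJigsaw 𝕜 _ fun n hn =>
    let ⟨_, hI⟩ := h n hn
    ⟨_, StoneSpace.isDenseClosedJigsaw_hull hn hI⟩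

theorem uncomplementedInSuperspace_lInftyModCZero (𝕜 : Type v) [RCLike 𝕜] :
    UncomplementedInSuperspace 𝕜 (LInftyModCZero 𝕜) Cardinal.continuum := by
  have h := PowerSetModFin.hasDenseJigsaws
  have := h.infinite
  have h1 := h.uncomplementedInSuperspace 𝕜
  rw [StoneSpace.densityCharacter_continuousMap, PowerSetModFin.mk_powerSetModFin,
    Cardinal.lift_continuum] at h1
  exact h1.of_linearIsometryEquiv (LinearIsometryEquiv.ofSurjective
    (LInftyModCZero.toContinuousMap 𝕜) LInftyModCZero.toContinuousMap_surjective)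

theorem mainTheorem10 (𝕜 : Type v) [RCLike 𝕜] :
    (∀ (K : Type u) [TopologicalSpace K] [CompactSpace K] [T2Space K],
      (∀ n : ℕ, 1 ≤ n → ∃ F : Fin n → Set K, IsDenseClosedJigsaw F) →
      UncomplementedInSuperspace 𝕜 C(K, 𝕜) (densityCharacter C(K, 𝕜))) ∧
    (∀ (𝓑 : Type u) [BooleanAlgebra 𝓑], HasDenseJigsaws 𝓑 →
      UncomplementedInSuperspace 𝕜 C(StoneSpace 𝓑, 𝕜)
        (densityCharacter C(StoneSpace 𝓑, 𝕜)) ∧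
      densityCharacter C(StoneSpace 𝓑, 𝕜) = Cardinal.lift.{v} #𝓑) ∧
    HasDenseJigsaws PowerSetModFin ∧
    UncomplementedInSuperspace 𝕜 (LInftyModCZero 𝕜) Cardinal.continuum ∧
    ¬ IsInjectiveBanachSpace 𝕜 (LInftyModCZero 𝕜) := by
  have h := PowerSetModFin.hasDenseJigsaws
  refine ⟨fun K _ _ _ hK => uncomplementedInSuperspace_of_isDenseClosedJigsaw 𝕜 K hK,
    fun 𝓑 _ h𝓑 => ⟨h𝓑.uncomplementedInSuperspace 𝕜, ?_⟩, h,
    uncomplementedInSuperspace_lInftyModCZero 𝕜,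
    (uncomplementedInSuperspace_lInftyModCZero 𝕜).not_isInjectiveBanachSpace⟩
  have := h𝓑.infinite
  exact StoneSpace.densityCharacter_continuousMap 𝓑 𝕜
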